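/- Let $\tfrac12<\alpha<1$, and let $C^\alpha_{\mathrm{even}}(\mathbb S)$ be the space of real-valued, even, $2\pi$-periodic, $\alpha$-Hölder continuous functions on $\mathbb R$, with norm the sum of the supremum norm and the $\alpha$-Hölder seminorm. For $\mu>0$ consider the steady Whitham equation $$-\mu\varphi+\varphi^2+K*\varphi=0,$$ where the kernel $K$ is determined by $\int_{\mathbb R}K(x)e^{-ix\xi}\,dx=\left(\frac{\tanh\xi}{\xi}\right)^{1/2}$ for all $\xi\in\mathbb R$ (with value $1$ at $\xi=0$), and the steady KdV equation $$(1-\mu)\varphi+\varphi^2+\tfrac16\varphi''=0 .$$ Then there is an integrable kernel $K$ with this Fourier transform, and for each of the two equations there are bounded, linear, compact operators $L(\mu)$ on $C^\alpha_{\mathrm{even}}(\mathbb S)$, $\mu>0$, such that, with $$F(\varphi,\mu):=\mu\varphi-L(\mu)\varphi+N(\varphi,\mu),\qquad N_{\mathrm W}(\varphi,\mu)=-\varphi^2,\qquad N_{\mathrm{KdV}}(\varphi,\mu)=-L(\mu)\varphi^2,$$ the following holds. 1. The map $F\colon C^\alpha_{\mathrm{even}}(\mathbb S)\times\mathbb R_{>0}\to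 C^\alpha_{\mathrm{even}}(\mathbb S)$ is real-analytic. 2. For all $\mu>0$ and $\varphi\in C^\alpha_{\mathrm{even}}(\mathbb S)$, $\varphi$ solves the equation if and only if $F(\varphi,\mu)=0$. (In the KdV case this is true both when the equation is understood in the sense of distributions and when it is understood classically, for $\varphi\in C^2$.) 3. For all $\mu>0$, $D_\varphi N[0,\mu]=0$, and $D_\varphi F[0,\mu]$ is a Fredholm operator of index $0$. In the Whitham case $L_{\mathrm W}\varphi=K*\varphi$, so that $L$ and $N$ do not depend on $\mu$. In the KdV case $L_{\mathrm{KdV}}(\mu)=\left(1-\frac1{6\mu}\partial_x^2\right)^{-1}$, that is, $L_{\mathrm{KdV}}(\mu)f=\frac1{2\tau}e^{-|\cdot|/\tau}*f$ with $\tau=(6\mu)^{-1/2}$, and $u=L_{\mathrm{KdV}}(\mu)f$ is a $C^2$ function with $u-\frac1{6\mu}u''=f$. -/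

import Mathlib

open scoped NNReal ContDiff Convolution

noncomputable section

namespace Whitham

/-- The real-valued functions on `ℝ` which are `2π`-periodic, even, and Hölder continuous with
exponent `α`. -/
def holderEvenSubmodule (α : ℝ≥0) : Submodule ℝ (ℝ → ℝ) where
  carrier := {f | Function.Periodic f (2 * Real.pi) ∧ (∀ x, f (-x) = f x) ∧ MemHolder α f}
  add_mem' := by
    rintro f g ⟨hf, hf', hf''⟩ ⟨hg, hg', hg''⟩
    exact ⟨hf.add hg, fun x => by simp [hf', hg'], hf''.add hg''⟩
  zero_mem' := ⟨fun x => rfl, fun x => rfl, memHolder_zero⟩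
  smul_mem' := by
    rintro c f ⟨hf, hf', hf''⟩
    exact ⟨hf.smul c, fun x => by simp [hf'], hf''.smul⟩

/-- The space `C^α_even(𝕊)`. It is a type of its own, so that it carries the Hölder norm
defined below and not the topology of pointwise convergence. -/
def HolderEven (α : ℝ≥0) : Type := holderEvenSubmodule α

namespace HolderEven

variable {α : ℝ≥0}

instance : AddCommGroup (HolderEven α) := inferInstanceAs (AddCommGroup (holderEvenSubmodule α))

instance : Module ℝ (HolderEven α) := inferInstanceAs (Module ℝ (holderEvenSubmodule α))

instance : FunLike (HolderEven α) ℝ ℝ := ⟨fun f => f.1, Subtype.val_injective⟩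

theorem ext {f g : HolderEven α} (h : ∀ x, f x = g x) : f = g :=
  DFunLike.ext f g h

theorem periodic (f : HolderEven α) : Function.Periodic f (2 * Real.pi) := f.2.1

theorem even (f : HolderEven α) (x : ℝ) : f (-x) = f x := f.2.2.1 x

theorem memHolder (f : HolderEven α) : MemHolder α f := f.2.2.2

theorem coe_add (f g : HolderEven α) : ⇑(f + g) = ⇑f + ⇑g := rfl

theorem coe_smul (c : ℝ) (f : HolderEven α) : ⇑(c • f) = c • ⇑f := rfl

theorem coe_zero : ⇑(0 : HolderEven α) = 0 := rfl

theorem bddAbove (f : HolderEven α) : BddAbove (Set.range fun x => |f x|) := by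
  obtain ⟨C, hC⟩ := f.memHolder
  refine ⟨|f 0| + C * (2 * Real.pi) ^ (α : ℝ), ?_⟩
  rintro _ ⟨x, rfl⟩
  obtain ⟨y, hy, hxy⟩ := f.periodic.exists_mem_Ico₀ (by positivity) x
  have h1 := hC.dist_le y 0
  rw [Real.dist_eq, Real.dist_eq, sub_zero, abs_of_nonneg hy.1] at h1
  have h2 : y ^ (α : ℝ) ≤ (2 * Real.pi) ^ (α : ℝ) :=
    Real.rpow_le_rpow hy.1 hy.2.le α.2
  have h3 : (C : ℝ) * y ^ (α : ℝ) ≤ C * (2 * Real.pi) ^ (α : ℝ) :=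
    mul_le_mul_of_nonneg_left h2 C.2
  have h4 := abs_sub_abs_le_abs_sub (f y) (f 0)
  simp only [hxy]
  linarith

/-- The Hölder norm: supremum norm plus Hölder seminorm. -/
instance : Norm (HolderEven α) := ⟨fun f => (⨆ x, |f x|) + nnHolderNorm α f⟩

theorem norm_def (f : HolderEven α) : ‖f‖ = (⨆ x, |f x|) + nnHolderNorm α f := rfl

theorem normCore : NormedSpace.Core ℝ (HolderEven α) where
  norm_nonneg f := add_nonneg (Real.iSup_nonneg fun _ => abs_nonneg _) (NNReal.coe_nonneg _)
  norm_smul c f := by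
    rw [norm_def, norm_def, coe_smul, f.memHolder.nnHolderNorm_smul, NNReal.coe_mul, mul_add,
      coe_nnnorm, Real.mul_iSup_of_nonneg (norm_nonneg c)]
    simp [abs_mul]
  norm_triangle f g := by
    have h1 : (⨆ x, |(f + g) x|) ≤ (⨆ x, |f x|) + ⨆ x, |g x| :=
      ciSup_le fun x => (abs_add_le (f x) (g x)).trans
        (add_le_add (le_ciSup f.bddAbove x) (le_ciSup g.bddAbove x))
    have h2 : (nnHolderNorm α ⇑(f + g) : ℝ) ≤ nnHolderNorm α ⇑f + nnHolderNorm α ⇑g := by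
      exact_mod_cast f.memHolder.nnHolderNorm_add_le g.memHolder
    rw [norm_def, norm_def, norm_def]
    linarith
  norm_eq_zero_iff f := by
    constructor
    · intro h
      refine ext fun x => ?_
      have h0 : (0 : ℝ) ≤ nnHolderNorm α ⇑f := NNReal.coe_nonneg _
      have h1 : |f x| ≤ ⨆ x, |f x| := le_ciSup f.bddAbove x
      rw [norm_def] at h
      exact abs_eq_zero.1 (le_antisymm (by linarith) (abs_nonneg _))
    · rintro rfl
      simp [norm_def, coe_zero]

instance : NormedAddCommGroup (HolderEven α) := NormedAddCommGroup.ofCore normCore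

instance : NormedSpace ℝ (HolderEven α) := NormedSpace.ofCore normCore

theorem memHolder_mul (f g : HolderEven α) : MemHolder α (⇑f * ⇑g) := by
  obtain ⟨M, hM⟩ := f.bddAbove
  obtain ⟨N, hN⟩ := g.bddAbove
  obtain ⟨C, hC⟩ := f.memHolder
  obtain ⟨D, hD⟩ := g.memHolder
  refine ⟨M.toNNReal * D + N.toNNReal * C, fun x y => ?_⟩
  have hfx : |f x| ≤ M.toNNReal := (hM ⟨x, rfl⟩).trans (Real.le_coe_toNNReal M)
  have hgy : |g y| ≤ N.toNNReal := (hN ⟨y, rfl⟩).trans (Real.le_coe_toNNReal N)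
  have h1 := hC.dist_le x y
  have h2 := hD.dist_le x y
  have key : dist ((⇑f * ⇑g) x) ((⇑f * ⇑g) y)
      ≤ (M.toNNReal * D + N.toNNReal * C : ℝ≥0) * dist x y ^ (α : ℝ) := by
    rw [Real.dist_eq] at h1 h2 ⊢
    have e : (⇑f * ⇑g) x - (⇑f * ⇑g) y = f x * (g x - g y) + g y * (f x - f y) := by
      simp only [Pi.mul_apply]; ring
    rw [e]
    refine (abs_add_le _ _).trans ?_
    rw [abs_mul, abs_mul]
    have a1 := mul_le_mul hfx h2 (abs_nonneg _) (NNReal.coe_nonneg _)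
    have a2 := mul_le_mul hgy h1 (abs_nonneg _) (NNReal.coe_nonneg _)
    push_cast
    linarith
  rw [edist_dist, edist_dist, ENNReal.ofReal_rpow_of_nonneg dist_nonneg (NNReal.coe_nonneg α),
    ← ENNReal.ofReal_coe_nnreal, ← ENNReal.ofReal_mul (NNReal.coe_nonneg _)]
  exact ENNReal.ofReal_le_ofReal key

/-- The pointwise product. -/
instance : Mul (HolderEven α) :=
  ⟨fun f g => ⟨⇑f * ⇑g, f.periodic.mul g.periodic, fun x => by simp [f.even, g.even],
    memHolder_mul f g⟩⟩

theorem mul_apply (f g : HolderEven α) (x : ℝ) : (f * g) x = f x * g x := rfl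

end HolderEven

/-- The symbol `(tanh ξ / ξ)^{1/2}`, with its continuous value `1` at `ξ = 0`. -/
def whithamSymbol (ξ : ℝ) : ℝ := if ξ = 0 then 1 else Real.sqrt (Real.tanh ξ / ξ)

/-- `K` is (a representative of) the Whitham kernel: the integrable function whose Fourier
transform `∫ K(x) exp(-ixξ) dx` is `(tanh ξ / ξ)^{1/2}`. -/
def IsWhithamKernel (K : ℝ → ℝ) : Prop :=
  MeasureTheory.Integrable K ∧
    ∀ ξ : ℝ, ∫ x : ℝ, (K x : ℂ) * Complex.exp (-(Complex.I * x * ξ)) = (whithamSymbol ξ : ℂ)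

/-- The steady Whitham equation `-μ φ + φ² + K ∗ φ = 0`. -/
def IsWhithamSolution (K : ℝ → ℝ) (μ : ℝ) (φ : ℝ → ℝ) : Prop :=
  ∀ x, -μ * φ x + φ x ^ 2 + (K ⋆ φ) x = 0

/-- The steady KdV equation `(1 - μ) φ + φ² + φ'' / 6 = 0` in the sense of distributions. -/
def IsKdVSolution (μ : ℝ) (φ : ℝ → ℝ) : Prop :=
  ∀ ψ : ℝ → ℝ, ContDiff ℝ ∞ ψ → HasCompactSupport ψ →
    ∫ x, (((1 - μ) * φ x + φ x ^ 2) * ψ x + 1 / 6 * φ x * iteratedDeriv 2 ψ x) = 0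

/-- The steady KdV equation `(1 - μ) φ + φ² + φ'' / 6 = 0` for twice continuously differentiable
functions. -/
def IsClassicalKdVSolution (μ : ℝ) (φ : ℝ → ℝ) : Prop :=
  ContDiff ℝ 2 φ ∧ ∀ x, (1 - μ) * φ x + φ x ^ 2 + 1 / 6 * iteratedDeriv 2 φ x = 0

/-- The kernel `(1 / (2τ)) exp(-|x| / τ)` of `(1 - τ² ∂ₓ²)⁻¹`. -/
def resolventKernel (τ : ℝ) (x : ℝ) : ℝ := 1 / (2 * τ) * Real.exp (-|x| / τ)

/-- The operator `F(φ, μ) = μ φ - L(μ) φ + N(φ, μ)`. -/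
def opF {α : ℝ≥0} (L : ℝ → HolderEven α →L[ℝ] HolderEven α)
    (N : HolderEven α × ℝ → HolderEven α) (p : HolderEven α × ℝ) : HolderEven α :=
  p.2 • p.1 - L p.2 p.1 + N p

/-- `A` is a Fredholm operator of index `0`. -/
def IsFredholmIndexZero {α : ℝ≥0} (A : HolderEven α →L[ℝ] HolderEven α) : Prop :=
  A.IsFredholm ∧ (A : HolderEven α →ₗ[ℝ] HolderEven α).index = 0

/-- The part of the functional-analytic formulation that is common to the two equations:
each `L(μ)` is compact, `F(φ, μ) = μ φ - L(μ) φ + N(φ, μ)` is analytic on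
`C^α_even(𝕊) × ℝ_{>0}`, its zeros are the solutions of the equation, `D_φ N[0, μ] = 0`, and
`D_φ F[0, μ]` is Fredholm of index `0`. -/
structure IsFormulation {α : ℝ≥0} (IsSolution : ℝ → (ℝ → ℝ) → Prop)
    (L : ℝ → HolderEven α →L[ℝ] HolderEven α) (N : HolderEven α × ℝ → HolderEven α) : Prop where
  compact : ∀ μ, 0 < μ → IsCompactOperator (L μ)
  analytic : AnalyticOnNhd ℝ (opF L N) {p | 0 < p.2}
  solution_iff : ∀ (φ : HolderEven α) (μ : ℝ), 0 < μ → (IsSolution μ φ ↔ opF L N (φ, μ) = 0)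
  deriv_N : ∀ μ, 0 < μ →
    HasFDerivAt (fun φ => N (φ, μ)) (0 : HolderEven α →L[ℝ] HolderEven α) 0
  fredholm : ∀ μ, 0 < μ → ∃ A : HolderEven α →L[ℝ] HolderEven α,
    HasFDerivAt (fun φ => opF L N (φ, μ)) A 0 ∧ IsFredholmIndexZero A

end Whitham

end

/-! Both operators `L(μ)` are convolutions with an integrable kernel `k`, and most of the theorem
follows from one fact: such an operator is a norm limit of finite-rank operators on `HolderEven α`.
Its norm is at most the L¹ norm of `k`, so `k` may be replaced by a compactly supported continuous
function, and that one by a trigonometric polynomial cut off to one period of length `N * (2π)`.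
Each frequency of such a polynomial gives an operator of rank at most one (`evenConv_mem_closure`).
Compactness follows, and `μ - L` is an invertible operator composed with a finite-rank perturbation
of the identity, hence Fredholm of index zero (`isFredholm_smul_id_sub`). The nonlinearities are
quadratic in a Banach algebra up to norm equivalence, so they are analytic with zero derivative at
the origin.

The Whitham kernel is built by a Pólya-type argument. Since `s m''(s)` is integrable for the symbol
`m`, the symbol is a superposition of triangle functions, and the same superposition of Fejér
kernels is an integrable function with that transform (`exists_integrable_fourier_eq`). For an
arbitrary Whitham kernel, evenness of the symbol and density of trigonometric polynomials show that
its odd part does not act on periodic functions.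

For KdV, `F(φ, μ) = 0` is the fixed-point equation `φ = L(μ)(μ⁻¹(φ + φ²))`. It is equivalent to the
differential equation because `w'' = 6μ w` has no nonzero periodic solution, classically or, after
mollification, in distributions. Analyticity in `μ` comes from the resolvent identity
(`kdvOp_resolvent`). -/

namespace Whitham

/-! ### Norm limits of finite-rank operators: compactness and Fredholm index -/

section FredholmTheory

open LinearMap

/-- The kernel of `id - G` lies in the range of `G`, and `x` is congruent to `G x` modulo the range
of `id - G`. Kernel and cokernel are therefore those of the restriction to the finite-dimensional
space `G.range`, where an endomorphism has index zero. -/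
theorem finrank_ker_id_sub_eq {V : Type*} [AddCommGroup V] [Module ℝ V] (G : V →ₗ[ℝ] V)
    (hG : G.HasFiniteRange) :
    FiniteDimensional ℝ (LinearMap.id - G).ker ∧
      FiniteDimensional ℝ (V ⧸ (LinearMap.id - G).range) ∧ (LinearMap.id - G).index = 0 := by
  set A : V →ₗ[ℝ] V := LinearMap.id - G with hA
  have hfd : FiniteDimensional ℝ G.range := Module.Finite.of_fg hG.fg_range
  have hmap : ∀ x ∈ G.range, A x ∈ G.range := fun x hx =>
    G.range.sub_mem hx (LinearMap.mem_range_self G x)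
  let g : G.range →ₗ[ℝ] G.range := A.restrict hmap
  have hker_le : A.ker ≤ G.range := fun x hx => by
    have h : x - G x = 0 := hx
    exact ⟨x, (sub_eq_zero.1 h).symm⟩
  have hker : g.ker = A.ker.comap G.range.subtype := by
    ext x
    simp [g, Subtype.ext_iff]
  let e₁ : g.ker ≃ₗ[ℝ] A.ker :=
    (LinearEquiv.ofEq _ _ hker).trans (Submodule.comapSubtypeEquivOfLe hker_le)
  let π : G.range →ₗ[ℝ] V ⧸ A.range := A.range.mkQ ∘ₗ G.range.subtype
  have hπ : Function.Surjective π := by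
    intro y
    obtain ⟨x, rfl⟩ := A.range.mkQ_surjective y
    refine ⟨⟨G x, LinearMap.mem_range_self G x⟩, ?_⟩
    refine (Submodule.Quotient.eq _).2 ⟨-x, ?_⟩
    simp [hA, neg_add_eq_sub]
  have hπker : π.ker = g.range := by
    ext x
    rw [LinearMap.mem_ker]
    change A.range.mkQ (x : V) = 0 ↔ _
    rw [Submodule.mkQ_apply, Submodule.Quotient.mk_eq_zero]
    constructor
    · rintro ⟨y, hy⟩
      have hyx : y = x + G y := by
        rw [← hy]; simp [hA]
      have hyV : y ∈ G.range := by
        rw [hyx]; exact G.range.add_mem x.2 (LinearMap.mem_range_self G y)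
      exact ⟨⟨y, hyV⟩, Subtype.ext hy⟩
    · rintro ⟨y, hy⟩
      exact ⟨y, congrArg Subtype.val hy⟩
  let e₂ : (G.range ⧸ g.range) ≃ₗ[ℝ] (V ⧸ A.range) :=
    (Submodule.quotEquivOfEq _ _ hπker.symm).trans (π.quotKerEquivOfSurjective hπ)
  refine ⟨Module.Finite.equiv e₁, Module.Finite.equiv e₂, ?_⟩
  have h : g.index = 0 := by rw [index_eq_of_finiteDimensional, sub_self]
  rw [index_eq_finrank_sub] at h ⊢
  rw [← e₁.finrank_eq, ← e₂.finrank_eq, h]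

variable {E : Type*} [NormedAddCommGroup E] [NormedSpace ℝ E]

variable (E) in
/-- The bounded operators of finite rank. -/
def finiteRankOperators : Submodule ℝ (E →L[ℝ] E) :=
  (LinearMap.finiteRange ℝ E E).comap (ContinuousLinearMap.coeLM ℝ)

theorem mem_finiteRankOperators {T : E →L[ℝ] E} :
    T ∈ finiteRankOperators E ↔ (T : E →ₗ[ℝ] E).HasFiniteRange :=
  mem_finiteRange_iff_hasFiniteRange

theorem isCompactOperator_of_mem_finiteRankOperators {T : E →L[ℝ] E}
    (hT : T ∈ finiteRankOperators E) : IsCompactOperator T := by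
  have hfd : FiniteDimensional ℝ (T : E →ₗ[ℝ] E).range :=
    Module.Finite.of_fg (mem_finiteRankOperators.1 hT).fg_range
  have : ProperSpace (T : E →ₗ[ℝ] E).range := FiniteDimensional.proper ℝ _
  let T' : E →L[ℝ] (T : E →ₗ[ℝ] E).range := T.codRestrict _ fun x => ⟨x, rfl⟩
  have hc : IsCompactOperator T' :=
    isCompactOperator_of_locallyCompactSpace_dom T'
  exact hc.clm_comp ((T : E →ₗ[ℝ] E).range.subtypeL)

theorem isCompactOperator_of_mem_closure [CompleteSpace E] {T : E →L[ℝ] E}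
    (hT : T ∈ (finiteRankOperators E).topologicalClosure) : IsCompactOperator T := by
  have h : (finiteRankOperators E).topologicalClosure ≤
      compactOperator (RingHom.id ℝ) E E := by
    rw [← compactOperator_topologicalClosure]
    exact Submodule.topologicalClosure_mono fun T hT =>
      isCompactOperator_of_mem_finiteRankOperators hT
  exact h hT

/-- If `L` is a norm limit of operators of finite rank and `μ ≠ 0`, then `μ - L` is a Fredholm
operator of index zero. -/
theorem isFredholm_smul_id_sub [CompleteSpace E] {L : E →L[ℝ] E} {μ : ℝ} (hμ : 0 < μ)
    (hL : L ∈ (finiteRankOperators E).topologicalClosure) :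
    (μ • ContinuousLinearMap.id ℝ E - L).IsFredholm ∧
      ((μ • ContinuousLinearMap.id ℝ E - L : E →L[ℝ] E) : E →ₗ[ℝ] E).index = 0 := by
  -- With `R` of finite rank at distance less than `μ` from `L`, the operator `e = μ - (L - R)` is
  -- invertible by a Neumann series, and `μ - L = e ∘ (id - e⁻¹ R)`.
  obtain ⟨R, hR, hRL⟩ := Metric.mem_closure_iff.1 hL μ hμ
  have hnorm : ‖μ⁻¹ • (L - R)‖ < 1 := by
    rw [norm_smul, norm_inv, Real.norm_of_nonneg hμ.le, ← dist_eq_norm, inv_mul_lt_iff₀ hμ,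
      mul_one]
    exact hRL
  let u : (E →L[ℝ] E)ˣ := Units.mk0 μ hμ.ne' • Units.oneSub (μ⁻¹ • (L - R)) hnorm
  let e : E ≃L[ℝ] E := ContinuousLinearEquiv.unitsEquiv ℝ E u
  have he : ∀ x, e x = μ • x - (L x - R x) := by
    intro x
    change (u : E →L[ℝ] E) x = _
    simp only [u, Units.val_smul, Units.val_oneSub, Units.smul_def, Units.val_mk0]
    simp [smul_sub, smul_smul, hμ.ne']
  set A : E →L[ℝ] E := μ • ContinuousLinearMap.id ℝ E - L with hA
  let G : E →ₗ[ℝ] E := (e.symm : E →ₗ[ℝ] E) ∘ₗ (R : E →ₗ[ℝ] E)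
  have hRf := mem_finiteRankOperators.1 hR
  have hG : G.HasFiniteRange := hRf.comp_left _
  have hcomp : (A : E →ₗ[ℝ] E) = e.toLinearEquiv.toLinearMap ∘ₗ (LinearMap.id - G) := by
    ext x
    have h1 : e (x - e.symm (R x)) = A x := by
      rw [map_sub, e.apply_symm_apply, he]
      simp only [hA, _root_.sub_apply, _root_.smul_apply,
        ContinuousLinearMap.id_apply]
      abel
    exact h1.symm
  obtain ⟨h1, h2, h3⟩ := finrank_ker_id_sub_eq G hG
  constructor
  · refine ContinuousLinearMap.IsFredholm.of_isQuasiInverse (v := (e.symm : E →L[ℝ] E)) ⟨?_, ?_⟩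
    · refine FiniteRangeSetoid.equiv_iff_hasFiniteRange.2 ?_
      have : (((e.symm : E →L[ℝ] E) : E →ₗ[ℝ] E) ∘ₗ (A : E →ₗ[ℝ] E) - LinearMap.id) = -G := by
        ext x
        rw [hcomp]
        simp [G]
      rw [this]
      exact hG.neg
    · refine FiniteRangeSetoid.equiv_iff_hasFiniteRange.2 ?_
      have : ((A : E →ₗ[ℝ] E) ∘ₗ ((e.symm : E →L[ℝ] E) : E →ₗ[ℝ] E) - LinearMap.id) =
          -((R : E →ₗ[ℝ] E) ∘ₗ (e.symm : E →ₗ[ℝ] E)) := by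
        ext x
        have h := he (e.symm x)
        rw [e.apply_symm_apply] at h
        simp only [LinearMap.sub_apply, LinearMap.comp_apply, LinearMap.neg_apply,
          LinearMap.id_apply]
        change A (e.symm x) - x = -(R (e.symm x))
        have h' : A (e.symm x) = μ • e.symm x - L (e.symm x) := by simp [hA]
        rw [h']
        nth_rewrite 3 [h]
        abel
      rw [this]
      exact (hRf.comp_right _).neg
  · rw [hcomp]
    have : FiniteDimensional ℝ e.toLinearEquiv.toLinearMap.ker := by
      rw [LinearEquiv.ker]; infer_instance
    have : FiniteDimensional ℝ (E ⧸ e.toLinearEquiv.toLinearMap.range) := by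
      rw [LinearEquiv.range]
      infer_instance
    rw [index_comp, h3, LinearEquiv.index_eq_zero, add_zero]

end FredholmTheory

end Whitham

open MeasureTheory Filter Topology

/-! ### The space of even Hölder functions: completeness and products -/

namespace Whitham

theorem memHolder_of_abs_sub_le {α : ℝ≥0} {g : ℝ → ℝ} {C : ℝ} (hC : 0 ≤ C)
    (h : ∀ x y, |g x - g y| ≤ C * |x - y| ^ (α : ℝ)) : HolderWith C.toNNReal α g := by
  intro x y
  rw [edist_dist, edist_dist, ENNReal.ofReal_rpow_of_nonneg dist_nonneg (NNReal.coe_nonneg α),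
    ← ENNReal.ofReal_coe_nnreal, ← ENNReal.ofReal_mul (NNReal.coe_nonneg _)]
  refine ENNReal.ofReal_le_ofReal ?_
  rw [Real.dist_eq, Real.dist_eq, Real.coe_toNNReal C hC]
  exact h x y

namespace HolderEven

variable {α : ℝ≥0}

/-- The supremum norm. -/
noncomputable def supNorm (f : HolderEven α) : ℝ := ⨆ x, |f x|

/-- The Hölder seminorm. -/
noncomputable def seminorm (f : HolderEven α) : ℝ := nnHolderNorm α f

theorem norm_eq (f : HolderEven α) : ‖f‖ = f.supNorm + f.seminorm := rfl

theorem abs_le_supNorm (f : HolderEven α) (x : ℝ) : |f x| ≤ f.supNorm := le_ciSup f.bddAbove x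

theorem supNorm_nonneg (f : HolderEven α) : 0 ≤ f.supNorm :=
  Real.iSup_nonneg fun _ => abs_nonneg _

theorem seminorm_nonneg (f : HolderEven α) : 0 ≤ f.seminorm := NNReal.coe_nonneg _

theorem supNorm_le_norm (f : HolderEven α) : f.supNorm ≤ ‖f‖ :=
  le_add_of_nonneg_right f.seminorm_nonneg

theorem seminorm_le_norm (f : HolderEven α) : f.seminorm ≤ ‖f‖ :=
  le_add_of_nonneg_left f.supNorm_nonneg

theorem abs_le_norm (f : HolderEven α) (x : ℝ) : |f x| ≤ ‖f‖ :=
  (f.abs_le_supNorm x).trans f.supNorm_le_norm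

theorem abs_sub_le (f : HolderEven α) (x y : ℝ) :
    |f x - f y| ≤ f.seminorm * |x - y| ^ (α : ℝ) := by
  have h := f.memHolder.holderWith.dist_le x y
  rwa [Real.dist_eq, Real.dist_eq] at h

theorem norm_le {f : HolderEven α} {M C : ℝ} (hM : ∀ x, |f x| ≤ M) (hC : 0 ≤ C)
    (h : ∀ x y, |f x - f y| ≤ C * |x - y| ^ (α : ℝ)) : ‖f‖ ≤ M + C := by
  refine add_le_add (ciSup_le hM) ?_
  have h1 := (memHolder_of_abs_sub_le hC h).nnholderNorm_le
  have h2 : ((nnHolderNorm α f : ℝ≥0) : ℝ) ≤ C.toNNReal := by exact_mod_cast h1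
  rwa [Real.coe_toNNReal C hC] at h2

/-- Constructor from a real Hölder bound. -/
def ofBound (g : ℝ → ℝ) (hp : Function.Periodic g (2 * Real.pi)) (he : ∀ x, g (-x) = g x)
    {C : ℝ} (hC : 0 ≤ C) (h : ∀ x y, |g x - g y| ≤ C * |x - y| ^ (α : ℝ)) : HolderEven α :=
  ⟨g, hp, he, (memHolder_of_abs_sub_le hC h).memHolder⟩

theorem add_apply (f g : HolderEven α) (x : ℝ) : (f + g) x = f x + g x := rfl

theorem smul_apply (c : ℝ) (f : HolderEven α) (x : ℝ) : (c • f) x = c * f x := rfl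

theorem neg_apply (f : HolderEven α) (x : ℝ) : (-f) x = -f x := rfl

theorem sub_apply (f g : HolderEven α) (x : ℝ) : (f - g) x = f x - g x := rfl

theorem zero_apply (x : ℝ) : (0 : HolderEven α) x = 0 := rfl

theorem continuous (hα : 0 < α) (f : HolderEven α) : Continuous f :=
  f.memHolder.holderWith.continuous hα

/-- The limit is taken pointwise. Letting `m → ∞` in the sup and Hölder bounds for `u n - u m` gives
the same bounds for `u n - g`. -/
instance : CompleteSpace (HolderEven α) := by
  refine Metric.complete_of_cauchySeq_tendsto fun u hu => ?_
  have hpt : ∀ x, ∃ y, Tendsto (fun n => u n x) atTop (𝓝 y) := by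
    intro x
    refine cauchySeq_tendsto_of_complete (Metric.cauchySeq_iff.2 fun ε hε => ?_)
    obtain ⟨N, hN⟩ := Metric.cauchySeq_iff.1 hu ε hε
    refine ⟨N, fun m hm n hn => lt_of_le_of_lt ?_ (hN m hm n hn)⟩
    rw [Real.dist_eq, dist_eq_norm, ← sub_apply]
    exact abs_le_norm _ x
  choose g hg using hpt
  have hp : Function.Periodic g (2 * Real.pi) := fun x =>
    tendsto_nhds_unique (hg _) ((hg x).congr fun n => ((u n).periodic x).symm)
  have he : ∀ x, g (-x) = g x := fun x =>
    tendsto_nhds_unique (hg _) ((hg x).congr fun n => ((u n).even x).symm)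
  have key : ∀ ε > 0, ∃ N, ∀ n ≥ N, (∀ x, |u n x - g x| ≤ ε) ∧
      ∀ x y, |(u n x - g x) - (u n y - g y)| ≤ ε * |x - y| ^ (α : ℝ) := by
    intro ε hε
    obtain ⟨N, hN⟩ := Metric.cauchySeq_iff.1 hu ε hε
    refine ⟨N, fun n hn => ⟨fun x => ?_, fun x y => ?_⟩⟩
    · refine le_of_tendsto ((tendsto_const_nhds.sub (hg x)).abs)
        (eventually_atTop.2 ⟨N, fun m hm => ?_⟩)
      have h := (hN n hn m hm).le
      rw [dist_eq_norm] at h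
      exact (abs_le_norm (u n - u m) x).trans h
    · refine le_of_tendsto (((tendsto_const_nhds.sub (hg x)).sub
        (tendsto_const_nhds.sub (hg y))).abs) (eventually_atTop.2 ⟨N, fun m hm => ?_⟩)
      have h := (hN n hn m hm).le
      rw [dist_eq_norm] at h
      exact (abs_sub_le (u n - u m) x y).trans
        (mul_le_mul_of_nonneg_right ((seminorm_le_norm _).trans h)
          (Real.rpow_nonneg (abs_nonneg _) _))
  obtain ⟨N, hN⟩ := key 1 one_pos
  have hbound : ∀ x y, |g x - g y| ≤ ((u N).seminorm + 1) * |x - y| ^ (α : ℝ) := by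
    intro x y
    have h1 := (hN N le_rfl).2 x y
    have h2 := abs_sub_le (u N) x y
    have h3 : g x - g y = (u N x - u N y) - ((u N x - g x) - (u N y - g y)) := by ring
    rw [h3, add_mul]
    exact (abs_sub _ _).trans (add_le_add h2 h1)
  refine ⟨ofBound g hp he (add_nonneg (seminorm_nonneg _) zero_le_one) hbound, ?_⟩
  refine Metric.tendsto_atTop.2 fun ε hε => ?_
  obtain ⟨M, hM⟩ := key (ε / 3) (by positivity)
  refine ⟨M, fun n hn => ?_⟩
  rw [dist_eq_norm]
  refine lt_of_le_of_lt (norm_le (hM n hn).1 (by positivity) (hM n hn).2) ?_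
  linarith

/-- The product rule for differences produces three of the four terms of the product of the norms;
the missing one, seminorm times seminorm, is nonnegative. -/
theorem norm_mul_le (f g : HolderEven α) : ‖f * g‖ ≤ ‖f‖ * ‖g‖ := by
  have hf := f.supNorm_nonneg
  have hg := g.supNorm_nonneg
  have hf' := f.seminorm_nonneg
  have hg' := g.seminorm_nonneg
  have h : ‖f * g‖ ≤ f.supNorm * g.supNorm +
      (f.supNorm * g.seminorm + f.seminorm * g.supNorm) := by
    refine norm_le (fun x => ?_) (by positivity) fun x y => ?_
    · rw [mul_apply, abs_mul]
      exact mul_le_mul (f.abs_le_supNorm x) (g.abs_le_supNorm x) (abs_nonneg _) hf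
    · have e : (f * g) x - (f * g) y = f x * (g x - g y) + (f x - f y) * g y := by
        simp only [mul_apply]; ring
      rw [e]
      refine (abs_add_le _ _).trans ?_
      rw [abs_mul, abs_mul]
      have a1 := mul_le_mul (f.abs_le_supNorm x) (g.abs_sub_le x y) (abs_nonneg _) hf
      have a2 := mul_le_mul (f.abs_sub_le x y) (g.abs_le_supNorm y) (abs_nonneg _)
        (mul_nonneg hf' (Real.rpow_nonneg (abs_nonneg _) _))
      linarith
  rw [norm_eq f, norm_eq g]
  nlinarith [mul_nonneg hf' hg']

variable (α) in
/-- The pointwise product as a bounded bilinear map. -/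
noncomputable def mulL : HolderEven α →L[ℝ] HolderEven α →L[ℝ] HolderEven α :=
  LinearMap.mkContinuous₂
    (LinearMap.mk₂ ℝ (fun f g => f * g)
      (fun f f' g => ext fun x => by simp only [mul_apply, add_apply]; ring)
      (fun c f g => ext fun x => by simp only [mul_apply, smul_apply]; ring)
      (fun f g g' => ext fun x => by simp only [mul_apply, add_apply]; ring)
      (fun c f g => ext fun x => by simp only [mul_apply, smul_apply]; ring))
    1 (fun f g => by rw [one_mul]; exact norm_mul_le f g)

theorem analyticOnNhd_mul_self (s : Set (HolderEven α)) :
    AnalyticOnNhd ℝ (fun f : HolderEven α => f * f) s := fun f _ =>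
  ((mulL α).analyticAt_bilinear (f, f)).comp₂ analyticAt_id analyticAt_id

theorem hasFDerivAt_mul_self :
    HasFDerivAt (fun f : HolderEven α => f * f) (0 : HolderEven α →L[ℝ] HolderEven α) 0 := by
  have h := (mulL α).hasFDerivAt_of_bilinear (hasFDerivAt_id (0 : HolderEven α))
    (hasFDerivAt_id (0 : HolderEven α))
  have e : (mulL α).precompR (HolderEven α) (0 : HolderEven α) (ContinuousLinearMap.id ℝ _) +
      (mulL α).precompL (HolderEven α) (ContinuousLinearMap.id ℝ _) (0 : HolderEven α) = 0 := by
    simp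
  exact e ▸ h

/-! ### Convolution operators with integrable kernels as limits of finite rank -/

theorem integrable_mul (hα : 0 < α) {k : ℝ → ℝ} (hk : Integrable k) (f : HolderEven α)
    {g : ℝ → ℝ} (hg : Continuous g) : Integrable fun t => k t * f (g t) := by
  refine hk.mul_bdd (c := f.supNorm) ((f.continuous hα).comp hg).aestronglyMeasurable ?_
  exact Eventually.of_forall fun t => f.abs_le_supNorm _

/-- Averaging over `x - t` and `x + t` makes the integral even in `x` for every integrable `k`, so
that kernels which are not even, such as cut-off trigonometric polynomials, also act on the space.
-/
theorem integrable_mul_avg (hα : 0 < α) {k : ℝ → ℝ} (hk : Integrable k) (f : HolderEven α)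
    (x : ℝ) : Integrable fun t => k t * ((f (x - t) + f (x + t)) / 2) := by
  have h1 := integrable_mul hα hk f (g := fun t => x - t) (by fun_prop)
  have h2 := integrable_mul hα hk f (g := fun t => x + t) (by fun_prop)
  refine ((h1.add h2).div_const 2).congr (Eventually.of_forall fun t => ?_)
  simp only [Pi.add_apply]
  ring

theorem abs_integral_mul_le {k : ℝ → ℝ} (hk : Integrable k) {g : ℝ → ℝ} {C : ℝ}
    (hg : ∀ t, |g t| ≤ C) : |∫ t, k t * g t| ≤ (∫ t, |k t|) * C := by
  rw [← Real.norm_eq_abs, ← integral_mul_const]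
  refine norm_integral_le_of_norm_le (hk.abs.mul_const C) (Eventually.of_forall fun t => ?_)
  rw [norm_mul, Real.norm_eq_abs, Real.norm_eq_abs]
  exact mul_le_mul_of_nonneg_left (hg t) (abs_nonneg _)

theorem abs_integral_avg_sub_le (hα : 0 < α) {k : ℝ → ℝ} (hk : Integrable k)
    (f : HolderEven α) (x y : ℝ) :
    |(∫ t, k t * ((f (x - t) + f (x + t)) / 2)) - ∫ t, k t * ((f (y - t) + f (y + t)) / 2)| ≤
      (∫ t, |k t|) * f.seminorm * |x - y| ^ (α : ℝ) := by
  rw [← integral_sub (integrable_mul_avg hα hk f x) (integrable_mul_avg hα hk f y)]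
  simp only [← mul_sub]
  rw [mul_assoc]
  refine abs_integral_mul_le hk fun t => ?_
  have h1 := f.abs_sub_le (x - t) (y - t)
  have h2 := f.abs_sub_le (x + t) (y + t)
  rw [sub_sub_sub_cancel_right] at h1
  rw [add_sub_add_right_eq_sub] at h2
  have e : (f (x - t) + f (x + t)) / 2 - (f (y - t) + f (y + t)) / 2 =
    ((f (x - t) - f (y - t)) + (f (x + t) - f (y + t))) / 2 := by ring
  rw [e, abs_div, abs_two, div_le_iff₀ two_pos]
  linarith [abs_add_le (f (x - t) - f (y - t)) (f (x + t) - f (y + t))]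

/-- The convolution with the even part of an integrable kernel. -/
noncomputable def evenConv (hα : 0 < α) (k : ℝ → ℝ) (hk : Integrable k) :
    HolderEven α →L[ℝ] HolderEven α :=
  LinearMap.mkContinuous
    { toFun := fun f => ofBound (fun x => ∫ t, k t * ((f (x - t) + f (x + t)) / 2))
        (fun x => by
          simp only [add_sub_right_comm, add_right_comm x (2 * Real.pi), f.periodic (x - _),
            f.periodic (x + _)])
        (fun x => by
          congr 1 with t
          rw [← f.even (-x - t), ← f.even (-x + t)]
          ring_nf)
        (mul_nonneg (integral_nonneg fun _ => abs_nonneg _) f.seminorm_nonneg)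
        (abs_integral_avg_sub_le hα hk f)
      map_add' := fun f g => ext fun x => by
        change (∫ t, k t * (((f + g) (x - t) + (f + g) (x + t)) / 2)) =
          (∫ t, k t * ((f (x - t) + f (x + t)) / 2)) + ∫ t, k t * ((g (x - t) + g (x + t)) / 2)
        rw [← integral_add (integrable_mul_avg hα hk f x) (integrable_mul_avg hα hk g x)]
        congr 1 with t
        simp only [add_apply]
        ring
      map_smul' := fun c f => ext fun x => by
        change (∫ t, k t * (((c • f) (x - t) + (c • f) (x + t)) / 2)) =
          c * ∫ t, k t * ((f (x - t) + f (x + t)) / 2)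
        rw [← integral_const_mul]
        congr 1 with t
        simp only [smul_apply]
        ring }
    (∫ t, |k t|) fun f => by
      rw [norm_eq f, mul_add]
      refine norm_le (fun x => ?_)
        (mul_nonneg (integral_nonneg fun _ => abs_nonneg _) f.seminorm_nonneg)
        (abs_integral_avg_sub_le hα hk f)
      refine abs_integral_mul_le hk fun t => ?_
      rw [abs_div, abs_two, div_le_iff₀ two_pos]
      linarith [abs_add_le (f (x - t)) (f (x + t)), f.abs_le_supNorm (x - t),
        f.abs_le_supNorm (x + t)]

theorem evenConv_apply (hα : 0 < α) {k : ℝ → ℝ} (hk : Integrable k) (f : HolderEven α) (x : ℝ) :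
    evenConv hα k hk f x = ∫ t, k t * ((f (x - t) + f (x + t)) / 2) := rfl

/-- This reduces approximation of operators to approximation of kernels in L¹. -/
theorem norm_evenConv_sub_le (hα : 0 < α) {k l : ℝ → ℝ} (hk : Integrable k) (hl : Integrable l) :
    ‖evenConv hα k hk - evenConv hα l hl‖ ≤ ∫ t, |k t - l t| := by
  have h : evenConv hα k hk - evenConv hα l hl = evenConv hα (k - l) (hk.sub hl) := by
    ext f
    refine ext fun x => ?_
    rw [_root_.sub_apply, sub_apply]
    simp only [evenConv_apply]
    rw [← integral_sub (integrable_mul_avg hα hk f x) (integrable_mul_avg hα hl f x)]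
    congr 1 with t
    simp only [Pi.sub_apply]
    ring
  rw [h]
  exact LinearMap.mkContinuous_norm_le _ (integral_nonneg fun _ => abs_nonneg _) _

/-- If the odd part of the kernel does not contribute, `evenConv` is the convolution. -/
theorem convolution_eq_evenConv (hα : 0 < α) {k : ℝ → ℝ} (hk : Integrable k) (f : HolderEven α)
    (x : ℝ) (h : ∫ t, k t * f (x - t) = ∫ t, k t * f (x + t)) :
    (k ⋆ f) x = evenConv hα k hk f x := by
  have h1 := integrable_mul hα hk f (g := fun t => x - t) (by fun_prop)
  have h2 := integrable_mul hα hk f (g := fun t => x + t) (by fun_prop)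
  have e : ∀ t, k t * ((f (x - t) + f (x + t)) / 2) =
    (k t * f (x - t) + k t * f (x + t)) / 2 := fun t => by ring
  rw [evenConv_apply]
  simp only [e]
  rw [integral_div, integral_add h1 h2, ← h, add_self_div_two]
  rfl

/-- The integral over a full period is translation invariant, so a shift of `f` can be moved onto
the kernel `c`. -/
theorem intervalIntegral_mul_comp_sub {P : ℝ} {c f : ℝ → ℝ} (hc : Function.Periodic c P)
    (hf : Function.Periodic f P) (a y : ℝ) :
    ∫ t in a..a + P, c t * f (t - y) = ∫ t in a..a + P, c (t + y) * f t := by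
  have hp : Function.Periodic (fun t => c (t + y) * f t) P := fun t => by
    simp only [hf t, add_right_comm t P y, hc (t + y)]
  have h := intervalIntegral.integral_comp_sub_right (fun t => c (t + y) * f t) y
    (a := a) (b := a + P)
  simp only [sub_add_cancel] at h
  rw [h, hp.intervalIntegral_add_eq a (a - y)]
  ring_nf

variable (α) in
/-- The multiples of `cos (b x)` which belong to `C^α_even(𝕊)`. -/
def cosSubmodule (b : ℝ) : Submodule ℝ (HolderEven α) where
  -- The frequency `b` will be a fraction with denominator `N`, so the cosine itself need not be
  -- `2π`-periodic; this condition does not require it to be an element of the space.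
  carrier := {g | ∀ x, g x = g 0 * Real.cos (b * x)}
  add_mem' := fun {f g} hf hg x => by
    rw [add_apply, add_apply, hf x, hg x]; ring
  zero_mem' := fun x => by simp [zero_apply]
  smul_mem' := fun c f hf x => by
    rw [smul_apply, smul_apply, hf x]; ring

theorem finiteDimensional_cosSubmodule (b : ℝ) : FiniteDimensional ℝ (cosSubmodule α b) := by
  let e : cosSubmodule α b →ₗ[ℝ] ℝ :=
    { toFun := fun g => g.1 0
      map_add' := fun _ _ => rfl
      map_smul' := fun _ _ => rfl }
  refine FiniteDimensional.of_injective e fun f g h => Subtype.ext (ext fun x => ?_)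
  have h' : f.1 0 = g.1 0 := h
  rw [f.2 x, g.2 x, h']

/-- A kernel supported in one period, satisfying the functional equation of the cosine, gives an
operator of rank at most one. -/
theorem evenConv_mem_finiteRankOperators (hα : 0 < α) {N : ℕ} {a b : ℝ} {c : ℝ → ℝ}
    (hc : Continuous c) (hcP : Function.Periodic c (N * (2 * Real.pi)))
    (hcos : ∀ t x, (c (t + x) + c (t - x)) / 2 = Real.cos (b * x) * c t)
    (hk : Integrable ((Set.Ioc a (a + N * (2 * Real.pi))).indicator c)) :
    evenConv hα _ hk ∈ finiteRankOperators (HolderEven α) := by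
  set P : ℝ := N * (2 * Real.pi) with hP
  have hP0 : 0 ≤ P := by positivity
  -- Evenness of `f` turns the two arguments into `t - x` and `t + x`; moving both shifts onto `c`
  -- and applying `hcos` separates the variables.
  have key : ∀ (f : HolderEven α) (x : ℝ),
      evenConv hα _ hk f x = (∫ t in a..a + P, c t * f t) * Real.cos (b * x) := by
    intro f x
    have hf : Function.Periodic f P := f.periodic.nat_mul N
    have hfc := f.continuous hα
    have e1 : ∀ t, (Set.Ioc a (a + P)).indicator c t * ((f (x - t) + f (x + t)) / 2) =
        (Set.Ioc a (a + P)).indicator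
          (fun t => (c t * f (t - x) + c t * f (t - (-x))) / 2) t := by
      intro t
      rw [← f.even (x - t), neg_sub, add_comm x t]
      by_cases ht : t ∈ Set.Ioc a (a + P)
      · simp only [Set.indicator_of_mem ht, sub_neg_eq_add]; ring
      · simp only [Set.indicator_of_notMem ht]; ring
    rw [evenConv_apply]
    simp only [e1]
    rw [integral_indicator measurableSet_Ioc,
      ← intervalIntegral.integral_of_le (le_add_of_nonneg_right hP0),
      intervalIntegral.integral_div, intervalIntegral.integral_add
        (Continuous.intervalIntegrable (by fun_prop) _ _)
        (Continuous.intervalIntegrable (by fun_prop) _ _),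
      intervalIntegral_mul_comp_sub hcP hf, intervalIntegral_mul_comp_sub hcP hf,
      ← intervalIntegral.integral_add
        (Continuous.intervalIntegrable (by fun_prop) _ _)
        (Continuous.intervalIntegrable (by fun_prop) _ _),
      ← intervalIntegral.integral_div, ← intervalIntegral.integral_mul_const]
    congr 1 with t
    have := hcos t x
    rw [← sub_eq_add_neg, ← add_mul, mul_div_right_comm, this]
    ring
  rw [mem_finiteRankOperators]
  have hle : (evenConv hα _ hk : HolderEven α →ₗ[ℝ] HolderEven α).range ≤ cosSubmodule α b := by
    rintro _ ⟨f, rfl⟩ x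
    change evenConv hα _ hk f x = evenConv hα _ hk f 0 * _
    rw [key, key]
    simp
  have := finiteDimensional_cosSubmodule (α := α) b
  have := Submodule.finiteDimensional_of_le hle
  exact (Submodule.fg_iff_finiteDimensional _).2 this

theorem integrable_indicator_Ioc {c : ℝ → ℝ} (hc : Continuous c) (a b : ℝ) :
    Integrable ((Set.Ioc a b).indicator c) :=
  (integrable_indicator_iff measurableSet_Ioc).2 (hc.integrableOn_Ioc)

theorem evenConv_add (hα : 0 < α) {k l m : ℝ → ℝ} (hk : Integrable k) (hl : Integrable l)
    (hm : Integrable m) (h : ∀ t, m t = k t + l t) :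
    evenConv hα m hm = evenConv hα k hk + evenConv hα l hl := by
  ext f
  refine ext fun x => ?_
  rw [_root_.add_apply, add_apply]
  simp only [evenConv_apply]
  rw [← integral_add (integrable_mul_avg hα hk f x) (integrable_mul_avg hα hl f x)]
  congr 1 with t
  rw [h, add_mul]

/-- Trigonometric polynomials, cut off to one period, give operators of finite rank. -/
theorem evenConv_trigPoly_mem (hα : 0 < α) {N : ℕ} [Fact (0 < (N * (2 * Real.pi) : ℝ))]
    (a : ℝ) (q : C(AddCircle (N * (2 * Real.pi) : ℝ), ℂ))
    (hq : q ∈ Submodule.span ℂ (Set.range (@fourier (N * (2 * Real.pi) : ℝ)))) (z : ℂ)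
    (hk : Integrable ((Set.Ioc a (a + N * (2 * Real.pi))).indicator
      fun t : ℝ => (z * q (t : AddCircle (N * (2 * Real.pi) : ℝ))).re)) :
    evenConv hα _ hk ∈ finiteRankOperators (HolderEven α) := by
  -- Taking real parts is not complex linear, so complex scalars are absorbed into the factor `z`.
  induction hq using Submodule.span_induction generalizing z with
  | mem q hq =>
    obtain ⟨n, rfl⟩ := hq
    refine evenConv_mem_finiteRankOperators hα (b := 2 * Real.pi * n / (N * (2 * Real.pi)))
      ?_ ?_ ?_ hk
    · exact Complex.continuous_re.comp (continuous_const.mul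
        ((fourier n).continuous.comp (AddCircle.continuous_mk' _)))
    · intro t
      simp only [AddCircle.coe_add_period]
    · intro t x
      simp only [fourier_coe_apply]
      have e1 : ∀ s : ℝ, 2 * (Real.pi : ℂ) * Complex.I * n * (s : ℝ) /
          ((N * (2 * Real.pi) : ℝ) : ℂ) =
          ((2 * Real.pi * n / (N * (2 * Real.pi)) * s : ℝ) : ℂ) * Complex.I := by
        intro s
        push_cast
        ring
      simp only [e1, Complex.mul_re, Complex.exp_ofReal_mul_I_re, Complex.exp_ofReal_mul_I_im,
        mul_add, mul_sub, Real.cos_add, Real.cos_sub, Real.sin_add, Real.sin_sub]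
      ring
  | zero =>
    have h : evenConv hα _ hk = 0 := by
      ext f
      refine ext fun x => ?_
      rw [evenConv_apply]
      simp [zero_apply]
    rw [h]
    exact Submodule.zero_mem _
  | add q r _ _ hq hr =>
    have hcont : ∀ q : C(AddCircle (N * (2 * Real.pi) : ℝ), ℂ), Continuous
        fun t : ℝ => (z * q (t : AddCircle (N * (2 * Real.pi) : ℝ))).re := fun q =>
      Complex.continuous_re.comp (continuous_const.mul
        (q.continuous.comp (AddCircle.continuous_mk' _)))
    have h1 := integrable_indicator_Ioc (hcont q) a (a + N * (2 * Real.pi))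
    have h2 := integrable_indicator_Ioc (hcont r) a (a + N * (2 * Real.pi))
    rw [evenConv_add hα h1 h2 hk]
    · exact Submodule.add_mem _ (hq z h1) (hr z h2)
    · intro t
      by_cases ht : t ∈ Set.Ioc a (a + N * (2 * Real.pi))
      · simp only [Set.indicator_of_mem ht, ContinuousMap.add_apply, mul_add, Complex.add_re]
      · simp only [Set.indicator_of_notMem ht, add_zero]
  | smul w q _ hq =>
    have e : (fun t : ℝ => (z * (w • q) (t : AddCircle (N * (2 * Real.pi) : ℝ))).re) =
        fun t : ℝ => ((z * w) * q (t : AddCircle (N * (2 * Real.pi) : ℝ))).re := by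
      funext t
      rw [ContinuousMap.smul_apply, smul_eq_mul, mul_assoc]
    have hk' := hk
    rw [e] at hk'
    have := hq (z * w) hk'
    simpa only [e] using this

/-- The kernel is approximated in L¹ by a continuous `g` of compact support, which is then regarded
as a function on a circle long enough to contain the support. There it is a uniform limit of
trigonometric polynomials. The circle has length a multiple of `2π` so that elements of the space
remain periodic on it. -/
theorem evenConv_mem_closure (hα : 0 < α) {k : ℝ → ℝ} (hk : Integrable k) :
    evenConv hα k hk ∈ (finiteRankOperators (HolderEven α)).topologicalClosure := by
  refine Metric.mem_closure_iff.2 fun ε hε => ?_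
  obtain ⟨g, hgs, hgk, hgc, hgi⟩ :=
    hk.exists_hasCompactSupport_integral_sub_le (ε := ε / 3) (by positivity)
  obtain ⟨R, hR⟩ := hgs.isCompact.isBounded.subset_closedBall (0 : ℝ)
  obtain ⟨N, hN⟩ := exists_nat_gt (max R 1)
  have hN1 : (1 : ℝ) < N := (le_max_right _ _).trans_lt hN
  have hNR : R < N := (le_max_left _ _).trans_lt hN
  set P : ℝ := N * (2 * Real.pi) with hP
  have hP0 : 0 < P := by positivity
  have hPR : R < P / 2 := by
    have := Real.two_le_pi
    rw [hP]
    nlinarith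
  have hT : Fact (0 < P) := ⟨hP0⟩
  have hg0 : ∀ t, P / 2 ≤ |t| → g t = 0 := fun t ht => by
    refine image_eq_zero_of_notMem_tsupport fun h => ?_
    have := hR h
    rw [mem_closedBall_zero_iff, Real.norm_eq_abs] at this
    linarith
  have hend : -(P / 2) + P = P / 2 := by ring
  let G : C(AddCircle P, ℂ) :=
    ⟨AddCircle.liftIoc P (-(P / 2)) fun t => (g t : ℂ), AddCircle.liftIoc_continuous (by
      rw [hend, hg0 _ (by rw [abs_neg]; exact le_abs_self _), hg0 _ (le_abs_self _)])
      (Complex.continuous_ofReal.comp hgc).continuousOn⟩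
  have hG : ∀ t ∈ Set.Ioc (-(P / 2)) (-(P / 2) + P), G (t : AddCircle P) = g t := fun t ht =>
    AddCircle.liftIoc_coe_apply (f := fun t => (g t : ℂ)) ht
  have hGmem : G ∈ (Submodule.span ℂ (Set.range (@fourier P))).topologicalClosure := by
    rw [span_fourier_closure_eq_top]; trivial
  -- A uniform error `ε / (3 * P)` over an interval of length `P` costs `ε / 3` in L¹.
  obtain ⟨q, hq, hqG⟩ := Metric.mem_closure_iff.1 hGmem (ε / (3 * P)) (by positivity)
  have hqc : Continuous fun t : ℝ => ((1 : ℂ) * q (t : AddCircle P)).re :=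
    Complex.continuous_re.comp (continuous_const.mul
      (q.continuous.comp (AddCircle.continuous_mk' _)))
  have hqi := integrable_indicator_Ioc hqc (-(P / 2)) (-(P / 2) + P)
  refine ⟨_, evenConv_trigPoly_mem hα (-(P / 2)) q hq 1 hqi, ?_⟩
  have h1 : ‖evenConv hα k hk - evenConv hα g hgi‖ ≤ ε / 3 :=
    (norm_evenConv_sub_le hα hk hgi).trans hgk
  have h2 : ‖evenConv hα g hgi - evenConv hα _ hqi‖ ≤ ε / 3 := by
    refine (norm_evenConv_sub_le hα hgi hqi).trans ?_
    have hpt : ∀ t, |g t - (Set.Ioc (-(P / 2)) (-(P / 2) + P)).indicator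
        (fun t : ℝ => ((1 : ℂ) * q (t : AddCircle P)).re) t| ≤
        (Set.Ioc (-(P / 2)) (-(P / 2) + P)).indicator (fun _ => ε / (3 * P)) t := by
      intro t
      by_cases ht : t ∈ Set.Ioc (-(P / 2)) (-(P / 2) + P)
      · simp only [Set.indicator_of_mem ht, one_mul]
        have e : g t - (q (t : AddCircle P)).re = (G (t : AddCircle P) - q (t : AddCircle P)).re := by
          rw [hG t ht, Complex.sub_re, Complex.ofReal_re]
        rw [e]
        refine (Complex.abs_re_le_norm _).trans ?_
        rw [← dist_eq_norm]
        exact (ContinuousMap.dist_apply_le_dist _).trans hqG.le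
      · simp only [Set.indicator_of_notMem ht, sub_zero]
        rw [hg0 t, abs_zero]
        rw [Set.mem_Ioc, not_and_or, not_lt, not_le, hend] at ht
        rcases ht with ht | ht
        · exact (by linarith : P / 2 ≤ -t).trans (neg_le_abs t)
        · exact ht.le.trans (le_abs_self t)
    refine (integral_mono (hgi.sub hqi).abs
      ((integrable_indicator_iff measurableSet_Ioc).2 (integrableOn_const (by simp))) hpt).trans ?_
    rw [integral_indicator measurableSet_Ioc, setIntegral_const]
    simp only [measureReal_def, Real.volume_Ioc, add_sub_cancel_left, smul_eq_mul]
    rw [ENNReal.toReal_ofReal hP0.le]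
    apply le_of_eq
    field_simp
  rw [dist_eq_norm]
  calc ‖evenConv hα k hk - evenConv hα _ hqi‖
      ≤ ‖evenConv hα k hk - evenConv hα g hgi‖ + ‖evenConv hα g hgi - evenConv hα _ hqi‖ :=
        norm_sub_le_norm_sub_add_norm_sub _ _ _
    _ < ε := by linarith

end HolderEven

/-! ### The Fejér kernel and its Fourier transform -/

section Fejer

open scoped FourierTransform

/-- The triangle function of half-width `s`. -/
noncomputable def triangle (s ξ : ℝ) : ℝ := max 0 (1 - |ξ| / s)

/-- The Fejér kernel, whose Fourier transform is the triangle function. -/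
noncomputable def fejerKernel (s x : ℝ) : ℝ := (1 - Real.cos (s * x)) / (Real.pi * s * x ^ 2)

theorem fejerKernel_nonneg {s : ℝ} (hs : 0 < s) (x : ℝ) : 0 ≤ fejerKernel s x :=
  div_nonneg (sub_nonneg.2 (Real.cos_le_one _)) (by positivity)

theorem continuous_triangle (s : ℝ) : Continuous (triangle s) := by
  unfold triangle
  fun_prop

theorem triangle_of_le {s ξ : ℝ} (hs : 0 < s) (h : s ≤ |ξ|) : triangle s ξ = 0 :=
  max_eq_left (sub_nonpos.2 ((one_le_div hs).2 h))

theorem triangle_of_abs_le {s ξ : ℝ} (hs : 0 < s) (h : |ξ| ≤ s) : triangle s ξ = 1 - |ξ| / s :=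
  max_eq_right (sub_nonneg.2 ((div_le_one hs).2 h))

theorem integrable_triangle {s : ℝ} (hs : 0 < s) : Integrable (triangle s) := by
  refine (continuous_triangle s).integrable_of_hasCompactSupport
    (HasCompactSupport.intro (isCompact_Icc (a := -s) (b := s)) fun x hx => ?_)
  refine triangle_of_le hs ?_
  by_contra! h
  exact hx ⟨(abs_lt.1 h).1.le, (abs_lt.1 h).2.le⟩

theorem integral_triangle_mul_cos {s w : ℝ} (hs : 0 < s) (hw : w ≠ 0) :
    ∫ ξ, triangle s ξ * Real.cos (w * ξ) = 2 * (1 - Real.cos (s * w)) / (s * w ^ 2) := by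
  have h1 : ∀ ξ, triangle s ξ * Real.cos (w * ξ) =
      (fun y => triangle s y * Real.cos (w * y)) |ξ| := by
    intro ξ
    have : triangle s |ξ| = triangle s ξ := by simp [triangle]
    simp only [this]
    rcases abs_choice ξ with h | h <;> rw [h]
    rw [mul_neg, Real.cos_neg]
  rw [funext h1, integral_comp_abs (f := fun y => triangle s y * Real.cos (w * y))]
  have h2 : ∫ y in Set.Ioi 0, triangle s y * Real.cos (w * y) =
      ∫ y in Set.Ioc 0 s, triangle s y * Real.cos (w * y) := by
    refine setIntegral_eq_of_subset_of_forall_sdiff_eq_zero measurableSet_Ioi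
      (fun y hy => hy.1) fun y hy => ?_
    have hys : s ≤ |y| := by
      by_contra! h
      exact hy.2 ⟨hy.1, (le_abs_self y).trans h.le⟩
    rw [triangle_of_le hs hys, zero_mul]
  have h3 : ∫ y in Set.Ioc 0 s, triangle s y * Real.cos (w * y) =
      ∫ y in (0 : ℝ)..s, (1 - y / s) * Real.cos (w * y) := by
    rw [intervalIntegral.integral_of_le hs.le]
    refine setIntegral_congr_fun measurableSet_Ioc fun y hy => ?_
    have hys : |y| ≤ s := (abs_of_pos hy.1).trans_le hy.2
    simp only [triangle_of_abs_le hs hys, abs_of_pos hy.1]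
  have h4 : ∀ y ∈ Set.uIcc 0 s, HasDerivAt
      (fun y => (1 - y / s) * (Real.sin (w * y) / w) - Real.cos (w * y) / (s * w ^ 2))
      ((1 - y / s) * Real.cos (w * y)) y := by
    intro y _
    have hwy : HasDerivAt (fun y => w * y) w y := by simpa using (hasDerivAt_id y).const_mul w
    have hlin : HasDerivAt (fun y => 1 - y / s) (-(1 / s)) y :=
      ((hasDerivAt_id y).div_const s).const_sub 1
    have := (hlin.mul (hwy.sin.div_const w)).sub (hwy.cos.div_const (s * w ^ 2))
    refine this.congr_deriv ?_
    field_simp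
    ring
  rw [h2, h3, intervalIntegral.integral_eq_sub_of_hasDerivAt h4
    (Continuous.intervalIntegrable (by fun_prop) _ _)]
  simp only [div_self hs.ne', sub_self, zero_mul, mul_zero, Real.sin_zero, zero_div, Real.cos_zero,
    mul_comm w s]
  ring

theorem fourier_triangle {s v : ℝ} (hs : 0 < s) (hv : v ≠ 0) :
    𝓕 (fun ξ => (triangle s ξ : ℂ)) v =
      ((2 * Real.pi * fejerKernel s (2 * Real.pi * v) : ℝ) : ℂ) := by
  have hπ := Real.pi_pos
  rw [Real.fourier_real_eq_integral_exp_smul]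
  set w : ℝ := 2 * Real.pi * v with hw
  have hw0 : w ≠ 0 := by positivity
  have e1 : ∀ ξ : ℝ, Complex.exp (↑(-2 * Real.pi * ξ * v) * Complex.I) • (triangle s ξ : ℂ) =
      ((triangle s ξ * Real.cos (w * ξ) : ℝ) : ℂ) -
        Complex.I * ((triangle s ξ * Real.sin (w * ξ) : ℝ) : ℂ) := by
    intro ξ
    have : -2 * Real.pi * ξ * v = -(w * ξ) := by rw [hw]; ring
    rw [this, Complex.exp_mul_I, ← Complex.ofReal_cos, ← Complex.ofReal_sin, Real.cos_neg,
      Real.sin_neg, smul_eq_mul]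
    push_cast
    ring
  have hi : ∀ g : ℝ → ℝ, Continuous g → (∀ x, |g x| ≤ 1) →
      Integrable fun ξ => triangle s ξ * g ξ := fun g hg hb =>
    (integrable_triangle hs).mul_bdd (c := 1) hg.aestronglyMeasurable
      (Eventually.of_forall hb)
  have hsin : ∫ ξ, triangle s ξ * Real.sin (w * ξ) = 0 := by
    have h := integral_neg_eq_self (fun ξ => triangle s ξ * Real.sin (w * ξ)) volume
    have e : ∀ ξ, triangle s (-ξ) * Real.sin (w * -ξ) = -(triangle s ξ * Real.sin (w * ξ)) := by
      intro ξ
      simp [triangle]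
    simp only [e, integral_neg] at h
    linarith
  simp only [e1]
  rw [integral_sub (hi _ (by fun_prop) fun x => Real.abs_cos_le_one _).ofReal
    ((hi _ (by fun_prop) fun x => Real.abs_sin_le_one _).ofReal.const_mul _),
    integral_const_mul, integral_complex_ofReal, integral_complex_ofReal, hsin,
    integral_triangle_mul_cos hs hw0]
  simp only [fejerKernel]
  rw [Complex.ofReal_zero, mul_zero, sub_zero]
  congr 1
  field_simp

/-- The transform is bounded by `A`, and its explicit form is bounded by `B / v²`, so it is
dominated by `(A + B) / (1 + v²)`. -/
theorem integrable_fourier_triangle {s : ℝ} (hs : 0 < s) :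
    Integrable (𝓕 (fun ξ => (triangle s ξ : ℂ))) := by
  have hπ := Real.pi_pos
  have hint : Integrable fun ξ => (triangle s ξ : ℂ) := (integrable_triangle hs).ofReal
  have hcont : Continuous (𝓕 (fun ξ => (triangle s ξ : ℂ))) :=
    VectorFourier.fourierIntegral_continuous Real.continuous_fourierChar
      (innerSL ℝ).continuous₂ hint
  set A : ℝ := ∫ ξ, ‖(triangle s ξ : ℂ)‖
  have hA : ∀ v, ‖𝓕 (fun ξ => (triangle s ξ : ℂ)) v‖ ≤ A := fun v => by
    rw [Real.fourier_real_eq_integral_exp_smul]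
    refine (norm_integral_le_integral_norm _).trans (le_of_eq ?_)
    simp only [norm_smul, Complex.norm_exp_ofReal_mul_I, one_mul, A]
  have hA0 : 0 ≤ A := (norm_nonneg _).trans (hA 0)
  set B : ℝ := 1 / (s * Real.pi ^ 2)
  have hB : ∀ v, v ^ 2 * ‖𝓕 (fun ξ => (triangle s ξ : ℂ)) v‖ ≤ B := fun v => by
    rcases eq_or_ne v 0 with rfl | hv
    · simp only [ne_eq, OfNat.ofNat_ne_zero, not_false_eq_true, zero_pow, zero_mul, B]
      positivity
    · rw [fourier_triangle hs hv, Complex.norm_real, Real.norm_of_nonneg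
        (mul_nonneg (by positivity) (fejerKernel_nonneg hs _))]
      have e : v ^ 2 * (2 * Real.pi * fejerKernel s (2 * Real.pi * v)) =
          (1 - Real.cos (s * (2 * Real.pi * v))) / 2 * B := by
        simp only [fejerKernel, B]
        field_simp
      rw [e]
      have := Real.neg_one_le_cos (s * (2 * Real.pi * v))
      exact mul_le_of_le_one_left (by positivity) (by linarith)
  refine (integrable_inv_one_add_sq.const_mul (A + B)).mono' hcont.aestronglyMeasurable
    (Eventually.of_forall fun v => ?_)
  rw [← div_eq_mul_inv, le_div_iff₀ (by positivity)]
  linarith [hA v, hB v]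

/-- The point `x = 0` is excluded because `fejerKernel s 0` is `0` by the convention for division by
zero. -/
theorem fejerKernel_ae_eq {s : ℝ} (hs : 0 < s) :
    (fun x => (fejerKernel s x : ℂ)) =ᵐ[volume] fun x =>
      ((2 * Real.pi)⁻¹ : ℂ) * 𝓕 (fun ξ => (triangle s ξ : ℂ)) (x / (2 * Real.pi)) := by
  have hπ := Real.pi_pos
  have h0 : ∀ᵐ x : ℝ, x ≠ 0 := by simp [ae_iff]
  filter_upwards [h0] with x hx
  have h2 : (2 * Real.pi : ℂ) ≠ 0 := by
    exact_mod_cast (by positivity : (2 * Real.pi : ℝ) ≠ 0)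
  rw [fourier_triangle hs (by positivity), mul_div_cancel₀ _ (by positivity), Complex.ofReal_mul]
  push_cast
  rw [inv_mul_cancel_left₀ h2]

theorem integrable_fejerKernel {s : ℝ} (hs : 0 < s) : Integrable (fejerKernel s) := by
  have h : Integrable fun x => (fejerKernel s x : ℂ) :=
    (((integrable_fourier_triangle hs).comp_div (by positivity)).const_mul _).congr
      (fejerKernel_ae_eq hs).symm
  exact h.re

/-- This is Fourier inversion for the triangle, evaluated at `-ξ` to match the sign in the exponent
and rescaled by `x = 2πv`. -/
theorem integral_fejerKernel_mul_exp {s : ℝ} (hs : 0 < s) (ξ : ℝ) :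
    ∫ x : ℝ, (fejerKernel s x : ℂ) * Complex.exp (-(Complex.I * x * ξ)) = triangle s ξ := by
  have hπ := Real.pi_pos
  have h2 : (2 * Real.pi : ℝ) ≠ 0 := by positivity
  have hinv := congrFun (Continuous.fourierInv_fourier_eq (f := fun ξ => (triangle s ξ : ℂ))
    (Complex.continuous_ofReal.comp (continuous_triangle s)) (integrable_triangle hs).ofReal
    (integrable_fourier_triangle hs)) (-ξ)
  rw [Real.fourierInv_eq'] at hinv
  have e : triangle s (-ξ) = triangle s ξ := by simp [triangle]
  rw [e] at hinv
  rw [← hinv]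
  have hsub := Measure.integral_comp_div (fun v : ℝ =>
    Complex.exp (↑(2 * Real.pi * inner ℝ v (-ξ)) * Complex.I) •
      𝓕 (fun ξ => (triangle s ξ : ℂ)) v) (2 * Real.pi)
  rw [abs_of_pos (by positivity)] at hsub
  have hsub' := congrArg (fun z => ((2 * Real.pi : ℝ)⁻¹) • z) hsub
  simp only [smul_smul, inv_mul_cancel₀ h2, one_smul] at hsub'
  rw [← hsub', ← integral_smul]
  refine integral_congr_ae ?_
  filter_upwards [fejerKernel_ae_eq hs] with x hx
  rw [hx, real_inner_comm]
  have e2 : (((2 * Real.pi * inner ℝ (-ξ) (x / (2 * Real.pi)) : ℝ) : ℂ) * Complex.I) =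
      -(Complex.I * x * ξ) := by
    have : (2 * Real.pi * inner ℝ (-ξ) (x / (2 * Real.pi)) : ℝ) = -(x * ξ) := by
      simp only [inner, star_trivial, RCLike.re_to_real]
      field_simp
    rw [this]
    push_cast
    ring
  rw [e2, Complex.real_smul, smul_eq_mul]
  push_cast
  ring

theorem integral_fejerKernel {s : ℝ} (hs : 0 < s) : ∫ x, fejerKernel s x = 1 := by
  have h := integral_fejerKernel_mul_exp hs 0
  simp only [Complex.ofReal_zero, mul_zero, neg_zero, Complex.exp_zero, mul_one] at h
  rw [integral_complex_ofReal] at h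
  have : triangle s 0 = 1 := by simp [triangle]
  rw [this] at h
  exact_mod_cast h

end Fejer

/-! ### Symbols that are superpositions of triangle functions -/

section QuasiConvex

theorem measurable_fejerKernel : Measurable (Function.uncurry fejerKernel) := by
  unfold fejerKernel Function.uncurry
  fun_prop

/-- Each Fejér kernel is nonnegative with integral one, so the integral of the absolute value in `x`
is just `|s * g s|`. -/
theorem integrable_weight_mul_fejerKernel {g : ℝ → ℝ}
    (hg : IntegrableOn (fun s => s * g s) (Set.Ioi 0)) :
    Integrable (fun z : ℝ × ℝ => z.1 * g z.1 * fejerKernel z.1 z.2)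
      ((volume.restrict (Set.Ioi 0)).prod volume) := by
  have hmeas : AEStronglyMeasurable (fun z : ℝ × ℝ => z.1 * g z.1 * fejerKernel z.1 z.2)
      ((volume.restrict (Set.Ioi 0)).prod volume) :=
    (hg.aestronglyMeasurable.comp_fst (f := fun s => s * g s)).mul
      measurable_fejerKernel.aestronglyMeasurable
  refine (integrable_prod_iff hmeas).2 ⟨?_, ?_⟩
  · filter_upwards [ae_restrict_mem measurableSet_Ioi] with s hs
    exact (integrable_fejerKernel hs).const_mul _
  · refine hg.norm.congr ?_
    filter_upwards [ae_restrict_mem measurableSet_Ioi] with s hs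
    have e : ∀ x, ‖s * g s * fejerKernel s x‖ = ‖s * g s‖ * fejerKernel s x := fun x => by
      rw [norm_mul, Real.norm_of_nonneg (fejerKernel_nonneg hs x)]
    simp only [e]
    rw [integral_const_mul, integral_fejerKernel hs, mul_one]

/-- Only `s > a = |ξ|` contributes, with integrand `(s - a) m''(s)`. Its primitive `(s - a) m' - m`
vanishes at infinity and equals `-m a` at `a`. -/
theorem integral_triangle_mul_deriv {m m' m'' : ℝ → ℝ}
    (hm : ∀ s, 0 < s → HasDerivAt m (m' s) s) (hm' : ∀ s, 0 < s → HasDerivAt m' (m'' s) s)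
    (hint : IntegrableOn (fun s => s * m'' s) (Set.Ioi 0)) (hlim : Tendsto m atTop (𝓝 0))
    (hlim' : Tendsto (fun s => s * m' s) atTop (𝓝 0)) {ξ : ℝ} (hξ : ξ ≠ 0) :
    ∫ s in Set.Ioi 0, s * m'' s * triangle s ξ = m |ξ| := by
  set a : ℝ := |ξ| with ha
  have ha0 : 0 < a := abs_pos.2 hξ
  have h1 : ∫ s in Set.Ioi 0, s * m'' s * triangle s ξ = ∫ s in Set.Ioi a, (s - a) * m'' s := by
    rw [setIntegral_eq_of_subset_of_forall_sdiff_eq_zero (s := Set.Ioi a) measurableSet_Ioi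
      (Set.Ioi_subset_Ioi ha0.le) fun s hs => by
        rw [triangle_of_le hs.1 (not_lt.1 hs.2), mul_zero]]
    refine setIntegral_congr_fun measurableSet_Ioi fun s hs => ?_
    have hs0 : 0 < s := ha0.trans hs
    simp only [triangle_of_abs_le hs0 (le_of_lt hs : |ξ| ≤ s), ← ha]
    field_simp
  have hintA : IntegrableOn (fun s => s * m'' s) (Set.Ioi a) :=
    hint.mono_set (Set.Ioi_subset_Ioi ha0.le)
  have h2 : IntegrableOn (fun s => (s - a) * m'' s) (Set.Ioi a) := by
    have hb : Integrable (fun s => s * m'' s * (1 - a / s)) (volume.restrict (Set.Ioi a)) := by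
      refine Integrable.mul_bdd (c := 1) hintA (by fun_prop) ?_
      filter_upwards [ae_restrict_mem measurableSet_Ioi] with s hs
      have hs0 : 0 < s := ha0.trans hs
      have h3 : a / s ≤ 1 := (div_le_one hs0).2 (le_of_lt hs)
      have h4 : 0 ≤ a / s := by positivity
      rw [Real.norm_of_nonneg (by linarith)]
      linarith
    refine hb.congr ?_
    filter_upwards [ae_restrict_mem measurableSet_Ioi] with s hs
    have hs0 : 0 < s := ha0.trans hs
    field_simp
  have hd : ∀ s, 0 < s → HasDerivAt (fun s => (s - a) * m' s - m s) ((s - a) * m'' s) s := by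
    intro s hs
    refine ((((hasDerivAt_id s).sub_const a).mul (hm' s hs)).sub (hm s hs)).congr_deriv ?_
    simp only [id]
    ring
  have hm'lim : Tendsto m' atTop (𝓝 0) := by
    refine (hlim'.mul (tendsto_inv_atTop_zero (𝕜 := ℝ))).congr' ?_ |>.trans (by simp)
    filter_upwards [eventually_gt_atTop 0] with s hs
    field_simp
  have hlim2 : Tendsto (fun s => (s - a) * m' s - m s) atTop (𝓝 0) := by
    have := (hlim'.sub (hm'lim.const_mul a)).sub hlim
    simp only [mul_zero, sub_zero] at this
    exact this.congr fun s => by ring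
  rw [h1, integral_Ioi_of_hasDerivAt_of_tendsto' (fun s hs => hd s (ha0.trans_le hs)) h2 hlim2]
  ring

theorem norm_exp_neg_I_mul (x ξ : ℝ) : ‖Complex.exp (-(Complex.I * x * ξ))‖ = 1 := by
  have : -(Complex.I * x * ξ) = ((-(x * ξ) : ℝ) : ℂ) * Complex.I := by push_cast; ring
  rw [this, Complex.norm_exp_ofReal_mul_I]

/-- A function `m` on `(0, ∞)` which vanishes at infinity and satisfies `∫ s |m''(s)| ds < ∞` is
the Fourier transform of an integrable function, away from the origin. -/
theorem exists_integrable_fourier_eq {m m' m'' : ℝ → ℝ}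
    (hm : ∀ s, 0 < s → HasDerivAt m (m' s) s) (hm' : ∀ s, 0 < s → HasDerivAt m' (m'' s) s)
    (hint : IntegrableOn (fun s => s * m'' s) (Set.Ioi 0)) (hlim : Tendsto m atTop (𝓝 0))
    (hlim' : Tendsto (fun s => s * m' s) atTop (𝓝 0)) :
    ∃ K : ℝ → ℝ, Integrable K ∧ ∀ ξ : ℝ, ξ ≠ 0 →
      ∫ x : ℝ, (K x : ℂ) * Complex.exp (-(Complex.I * x * ξ)) = (m |ξ| : ℂ) := by
  have hprod := integrable_weight_mul_fejerKernel hint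
  -- The weight `s m''(s)` is the one with which triangles reproduce `m`; Fubini carries this over
  -- to the Fejér kernels.
  refine ⟨fun x => ∫ s in Set.Ioi 0, s * m'' s * fejerKernel s x, hprod.integral_prod_right,
    fun ξ hξ => ?_⟩
  have hexp : Continuous fun z : ℝ × ℝ => Complex.exp (-(Complex.I * z.2 * ξ)) := by fun_prop
  have hprod' : Integrable (fun z : ℝ × ℝ => ((z.1 * m'' z.1 * fejerKernel z.1 z.2 : ℝ) : ℂ) *
      Complex.exp (-(Complex.I * z.2 * ξ))) ((volume.restrict (Set.Ioi 0)).prod volume) :=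
    hprod.ofReal.mul_bdd (c := 1) hexp.aestronglyMeasurable
      (Eventually.of_forall fun z => (norm_exp_neg_I_mul z.2 ξ).le)
  have h1 : ∀ x : ℝ, ((∫ s in Set.Ioi 0, s * m'' s * fejerKernel s x : ℝ) : ℂ) *
      Complex.exp (-(Complex.I * x * ξ)) =
      ∫ s in Set.Ioi 0, ((s * m'' s * fejerKernel s x : ℝ) : ℂ) *
        Complex.exp (-(Complex.I * x * ξ)) := by
    intro x
    rw [integral_mul_const, integral_complex_ofReal]
  simp only [h1]
  rw [← integral_integral_swap (f := fun s x => ((s * m'' s * fejerKernel s x : ℝ) : ℂ) *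
    Complex.exp (-(Complex.I * x * ξ))) hprod',
    ← integral_triangle_mul_deriv hm hm' hint hlim hlim' hξ, ← integral_complex_ofReal]
  refine setIntegral_congr_fun measurableSet_Ioi fun s hs => ?_
  have e : ∀ x : ℝ, ((s * m'' s * fejerKernel s x : ℝ) : ℂ) * Complex.exp (-(Complex.I * x * ξ)) =
      ((s * m'' s : ℝ) : ℂ) * ((fejerKernel s x : ℂ) * Complex.exp (-(Complex.I * x * ξ))) := by
    intro x
    push_cast
    ring
  simp only [e]
  rw [integral_const_mul, integral_fejerKernel_mul_exp hs, ← Complex.ofReal_mul]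

end QuasiConvex

/-! ### Estimates for the Whitham symbol and existence of the kernel -/

section WhithamKernel

theorem hasDerivAt_tanh (s : ℝ) : HasDerivAt Real.tanh (1 - Real.tanh s ^ 2) s := by
  have h : Real.tanh = fun s => Real.sinh s / Real.cosh s :=
    funext Real.tanh_eq_sinh_div_cosh
  have hc := (Real.cosh_pos s).ne'
  rw [h]
  refine ((Real.hasDerivAt_sinh s).div (Real.hasDerivAt_cosh s) hc).congr_deriv ?_
  field_simp

theorem continuous_tanh : Continuous Real.tanh :=
  continuous_iff_continuousAt.2 fun s => (hasDerivAt_tanh s).continuousAt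

theorem nonneg_of_hasDerivAt_nonneg {f f' : ℝ → ℝ} (h0 : f 0 = 0)
    (hf : ∀ s, HasDerivAt f (f' s) s) (hf' : ∀ s, 0 < s → 0 ≤ f' s) {s : ℝ} (hs : 0 ≤ s) :
    0 ≤ f s := by
  have hmono : MonotoneOn f (Set.Ici 0) := by
    refine monotoneOn_of_deriv_nonneg (convex_Ici 0)
      (fun x _ => (hf x).continuousAt.continuousWithinAt)
      (fun x _ => (hf x).differentiableAt.differentiableWithinAt) fun x hx => ?_
    rw [interior_Ici] at hx
    rw [(hf x).deriv]
    exact hf' x hx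
  have := hmono Set.self_mem_Ici hs hs
  rwa [h0] at this

theorem tanh_pos {s : ℝ} (hs : 0 < s) : 0 < Real.tanh s := by
  rw [Real.tanh_eq_sinh_div_cosh]
  exact div_pos (Real.sinh_pos_iff.2 hs) (Real.cosh_pos s)

theorem tanh_le_self {s : ℝ} (hs : 0 ≤ s) : Real.tanh s ≤ s := by
  have := nonneg_of_hasDerivAt_nonneg (f := fun s => s - Real.tanh s)
    (f' := fun s => 1 - (1 - Real.tanh s ^ 2)) (by simp)
    (fun s => (hasDerivAt_id s).sub (hasDerivAt_tanh s)) (fun s _ => by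
      have := sq_nonneg (Real.tanh s); linarith) hs
  linarith

/-- `tanh s - s tanh' s`, which is `-s²` times the derivative of `tanh s / s`. -/
noncomputable def tanhDefect (s : ℝ) : ℝ := Real.tanh s - s * (1 - Real.tanh s ^ 2)

theorem hasDerivAt_tanhDefect (s : ℝ) :
    HasDerivAt tanhDefect (2 * s * Real.tanh s * (1 - Real.tanh s ^ 2)) s := by
  have h := hasDerivAt_tanh s
  refine (h.sub ((hasDerivAt_id s).mul ((h.pow 2).const_sub 1))).congr_deriv ?_
  simp only [id, Pi.pow_apply]
  push_cast
  ring

theorem one_sub_tanh_sq_nonneg (s : ℝ) : 0 ≤ 1 - Real.tanh s ^ 2 :=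
  sub_nonneg.2 (Real.tanh_sq_lt_one s).le

theorem tanhDefect_nonneg {s : ℝ} (hs : 0 ≤ s) : 0 ≤ tanhDefect s :=
  nonneg_of_hasDerivAt_nonneg (by simp [tanhDefect]) hasDerivAt_tanhDefect
    (fun s hs => mul_nonneg (mul_nonneg (by positivity) (tanh_pos hs).le)
      (one_sub_tanh_sq_nonneg s)) hs

theorem tanhDefect_le_one {s : ℝ} (hs : 0 ≤ s) : tanhDefect s ≤ 1 := by
  have h1 := mul_nonneg hs (one_sub_tanh_sq_nonneg s)
  have h2 := Real.tanh_lt_one s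
  unfold tanhDefect
  linarith

theorem tanhDefect_le_pow {s : ℝ} (hs : 0 < s) : tanhDefect s ≤ s ^ 3 := by
  have h1 := tanh_le_self hs.le
  have h2 : Real.tanh s ^ 2 ≤ s ^ 2 := pow_le_pow_left₀ (tanh_pos hs).le h1 2
  have h3 := mul_le_mul_of_nonneg_left h2 hs.le
  unfold tanhDefect
  linarith

theorem one_sub_tanh_sq_le {s : ℝ} (hs : 0 < s) : 1 - Real.tanh s ^ 2 ≤ 1 / s ^ 2 := by
  have hc := Real.cosh_pos s
  have h1 : 1 - Real.tanh s ^ 2 = 1 / Real.cosh s ^ 2 := by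
    rw [Real.tanh_eq_sinh_div_cosh]
    have := Real.cosh_sq s
    field_simp
    linarith
  rw [h1]
  have h2 : s ≤ Real.cosh s := (Real.self_le_sinh_iff.2 hs.le).trans (Real.sinh_lt_cosh s).le
  exact one_div_le_one_div_of_le (by positivity) (pow_le_pow_left₀ hs.le h2 2)

/-- The symbol on the positive half-line. -/
noncomputable def symb (s : ℝ) : ℝ := √(Real.tanh s / s)

/-- The first derivative of `tanh s / s`. -/
noncomputable def ratioDeriv (s : ℝ) : ℝ := -tanhDefect s / s ^ 2

/-- The second derivative of `tanh s / s`. -/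
noncomputable def ratioDeriv₂ (s : ℝ) : ℝ :=
  2 * tanhDefect s / s ^ 3 - 2 * Real.tanh s * (1 - Real.tanh s ^ 2) / s

/-- The first derivative of the symbol. -/
noncomputable def symbDeriv (s : ℝ) : ℝ := ratioDeriv s / (2 * symb s)

/-- The second derivative of the symbol. -/
noncomputable def symbDeriv₂ (s : ℝ) : ℝ :=
  ratioDeriv₂ s / (2 * symb s) - ratioDeriv s ^ 2 / (4 * symb s ^ 3)

theorem symb_pos {s : ℝ} (hs : 0 < s) : 0 < symb s :=
  Real.sqrt_pos.2 (div_pos (tanh_pos hs) hs)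

theorem hasDerivAt_ratio {s : ℝ} (hs : 0 < s) :
    HasDerivAt (fun s => Real.tanh s / s) (ratioDeriv s) s := by
  refine ((hasDerivAt_tanh s).div (hasDerivAt_id s) hs.ne').congr_deriv ?_
  simp only [ratioDeriv, tanhDefect, id]
  ring

theorem hasDerivAt_ratioDeriv {s : ℝ} (hs : 0 < s) :
    HasDerivAt ratioDeriv (ratioDeriv₂ s) s := by
  refine ((hasDerivAt_tanhDefect s).neg.div (hasDerivAt_pow 2 s) (by positivity)).congr_deriv ?_
  simp only [ratioDeriv₂, Pi.neg_apply]
  push_cast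
  field_simp
  ring

theorem hasDerivAt_symb {s : ℝ} (hs : 0 < s) : HasDerivAt symb (symbDeriv s) s :=
  (hasDerivAt_ratio hs).sqrt (div_pos (tanh_pos hs) hs).ne'

theorem hasDerivAt_symbDeriv {s : ℝ} (hs : 0 < s) :
    HasDerivAt symbDeriv (symbDeriv₂ s) s := by
  have hm := symb_pos hs
  refine ((hasDerivAt_ratioDeriv hs).div ((hasDerivAt_symb hs).const_mul 2)
    (by positivity)).congr_deriv ?_
  simp only [symbDeriv₂, symbDeriv]
  field_simp
  ring

theorem abs_symbDeriv₂_le {s A B c : ℝ} (hc : 0 < c) (hcs : c ≤ symb s)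
    (hA : |ratioDeriv s| ≤ A) (hB : |ratioDeriv₂ s| ≤ B) :
    |symbDeriv₂ s| ≤ B / (2 * c) + A ^ 2 / (4 * c ^ 3) := by
  have hm : 0 < symb s := hc.trans_le hcs
  have hB0 : 0 ≤ B := (abs_nonneg _).trans hB
  have hA0 : 0 ≤ A := (abs_nonneg _).trans hA
  refine (abs_sub _ _).trans (add_le_add ?_ ?_)
  · rw [abs_div, abs_of_pos (by positivity : 0 < 2 * symb s)]
    exact div_le_div₀ hB0 hB (by positivity) (by linarith)
  · rw [abs_div, abs_of_pos (by positivity : 0 < 4 * symb s ^ 3), abs_pow]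
    exact div_le_div₀ (by positivity) (pow_le_pow_left₀ (abs_nonneg _) hA 2) (by positivity)
      (mul_le_mul_of_nonneg_left (pow_le_pow_left₀ hc.le hcs 3) (by norm_num))

theorem monotone_tanh : Monotone Real.tanh :=
  monotone_of_deriv_nonneg (fun s => (hasDerivAt_tanh s).differentiableAt) fun s => by
    rw [(hasDerivAt_tanh s).deriv]; exact one_sub_tanh_sq_nonneg s

/-- The bound `tanhDefect s ≤ s ^ 3` cancels the powers of `s` in the denominators. Nonnegativity of
`tanhDefect` says `tanh s / s ≥ 1 - tanh² s`, which keeps the symbol away from zero. -/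
theorem abs_symbDeriv₂_le_of_le_one :
    ∃ C, ∀ s, 0 < s → s ≤ 1 → |symbDeriv₂ s| ≤ C := by
  have hc : 0 < √(1 - Real.tanh 1 ^ 2) := Real.sqrt_pos.2 (sub_pos.2 (Real.tanh_sq_lt_one 1))
  refine ⟨_, fun s hs hs1 => abs_symbDeriv₂_le (A := 1) (B := 4) hc ?_ ?_ ?_⟩
  · refine Real.sqrt_le_sqrt ?_
    rw [le_div_iff₀ hs]
    have h1 := tanhDefect_nonneg hs.le
    have h2 : Real.tanh s ^ 2 ≤ Real.tanh 1 ^ 2 :=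
      pow_le_pow_left₀ (tanh_pos hs).le (monotone_tanh hs1) 2
    have h3 := mul_le_mul_of_nonneg_right h2 hs.le
    unfold tanhDefect at h1
    linarith
  · have h1 := tanhDefect_nonneg hs.le
    rw [ratioDeriv, abs_div, abs_neg, abs_of_nonneg h1, abs_of_pos (by positivity),
      div_le_one (by positivity)]
    refine (tanhDefect_le_pow hs).trans ?_
    nlinarith [sq_nonneg s]
  · have h1 := tanhDefect_nonneg hs.le
    have h2 : 2 * tanhDefect s / s ^ 3 ≤ 2 := by
      rw [div_le_iff₀ (by positivity)]
      linarith [tanhDefect_le_pow hs]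
    have h3 : 0 ≤ 2 * tanhDefect s / s ^ 3 := by positivity
    have h4 := one_sub_tanh_sq_nonneg s
    have h5 := tanh_pos hs
    have h6 : 0 ≤ 2 * Real.tanh s * (1 - Real.tanh s ^ 2) / s := by positivity
    have h7 : 2 * Real.tanh s * (1 - Real.tanh s ^ 2) / s ≤ 2 := by
      rw [div_le_iff₀ hs]
      have : Real.tanh s * (1 - Real.tanh s ^ 2) ≤ s * 1 :=
        mul_le_mul (tanh_le_self hs.le) (by nlinarith [sq_nonneg (Real.tanh s)]) h4 hs.le
      linarith
    rw [ratioDeriv₂, abs_le]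
    constructor <;> linarith

theorem le_symb_of_one_le {s : ℝ} (hs : 1 ≤ s) : √(Real.tanh 1) / √s ≤ symb s := by
  rw [symb, Real.sqrt_div (tanh_pos (by linarith)).le]
  exact div_le_div_of_nonneg_right (Real.sqrt_le_sqrt (monotone_tanh hs)) (Real.sqrt_nonneg _)

theorem abs_ratioDeriv_le {s : ℝ} (hs : 0 < s) : |ratioDeriv s| ≤ 1 / s ^ 2 := by
  rw [ratioDeriv, abs_div, abs_neg, abs_of_nonneg (tanhDefect_nonneg hs.le),
    abs_of_pos (by positivity : 0 < s ^ 2)]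
  exact div_le_div_of_nonneg_right (tanhDefect_le_one hs.le) (by positivity)

theorem abs_ratioDeriv₂_le {s : ℝ} (hs : 0 < s) : |ratioDeriv₂ s| ≤ 4 / s ^ 3 := by
  have h1 := tanhDefect_nonneg hs.le
  have h2 : 2 * tanhDefect s / s ^ 3 ≤ 2 / s ^ 3 :=
    div_le_div_of_nonneg_right (by linarith [tanhDefect_le_one hs.le]) (by positivity)
  have h3 : 0 ≤ 2 * tanhDefect s / s ^ 3 := by positivity
  have h4 := one_sub_tanh_sq_nonneg s
  have h5 := tanh_pos hs
  have h6 : 0 ≤ 2 * Real.tanh s * (1 - Real.tanh s ^ 2) / s := by positivity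
  have h7 : 2 * Real.tanh s * (1 - Real.tanh s ^ 2) / s ≤ 2 / s ^ 3 := by
    have : Real.tanh s * (1 - Real.tanh s ^ 2) ≤ 1 * (1 / s ^ 2) :=
      mul_le_mul (Real.tanh_lt_one s).le (one_sub_tanh_sq_le hs) h4 zero_le_one
    have e : 2 / s ^ 3 = 2 * (1 * (1 / s ^ 2)) / s := by field_simp
    rw [e, mul_assoc]
    exact div_le_div_of_nonneg_right (mul_le_mul_of_nonneg_left this zero_le_two) hs.le
  have h8 : 4 / s ^ 3 = 2 / s ^ 3 + 2 / s ^ 3 := by ring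
  have h9 : 0 ≤ 2 / s ^ 3 := by positivity
  rw [ratioDeriv₂, abs_le, h8]
  constructor <;> linarith

/-- The symbol is at least a constant times `s^(-1/2)`, and the two derivatives of `tanh s / s` are
of order `s⁻²` and `s⁻³`. Hence the second derivative of the symbol is of order `s^(-5/2)`, enough
for integrability at infinity after multiplication by `s`. -/
theorem abs_symbDeriv₂_le_of_one_le :
    ∃ C, ∀ s, 1 ≤ s → |s * symbDeriv₂ s| ≤ C * s ^ (-3 / 2 : ℝ) := by
  set c : ℝ := √(Real.tanh 1) with hcdef
  have hc : 0 < c := Real.sqrt_pos.2 (tanh_pos one_pos)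
  refine ⟨2 / c + 1 / (4 * c ^ 3), fun s hs => ?_⟩
  have hs0 : 0 < s := by linarith
  have hr : 0 < √s := Real.sqrt_pos.2 hs0
  have h := abs_symbDeriv₂_le (div_pos hc hr) (le_symb_of_one_le hs) (abs_ratioDeriv_le hs0)
    (abs_ratioDeriv₂_le hs0)
  have e1 : s ^ (-3 / 2 : ℝ) = √s / s ^ 2 := by
    rw [Real.sqrt_eq_rpow, ← Real.rpow_natCast s 2, ← Real.rpow_sub hs0]
    norm_num
  rw [abs_mul, abs_of_pos hs0, e1]
  refine (mul_le_mul_of_nonneg_left h hs0.le).trans (le_of_eq ?_)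
  have e2 : s = √s ^ 2 := (Real.sq_sqrt hs0.le).symm
  generalize √s = r at *
  subst e2
  field_simp
  ring

theorem measurable_symbDeriv₂ : Measurable symbDeriv₂ := by
  have h := continuous_tanh.measurable
  have hs : Measurable symb := (h.div measurable_id).sqrt
  have hd : Measurable tanhDefect := h.sub (measurable_id.mul ((h.pow_const 2).const_sub 1))
  have h1 : Measurable ratioDeriv := hd.neg.div (measurable_id.pow_const 2)
  have h2 : Measurable ratioDeriv₂ := ((hd.const_mul 2).div (measurable_id.pow_const 3)).sub
    (((h.const_mul 2).mul ((h.pow_const 2).const_sub 1)).div measurable_id)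
  exact (h2.div (hs.const_mul 2)).sub ((h1.pow_const 2).div ((hs.pow_const 3).const_mul 4))

theorem integrableOn_mul_symbDeriv₂ :
    IntegrableOn (fun s => s * symbDeriv₂ s) (Set.Ioi 0) := by
  have hmeas : Measurable fun s => s * symbDeriv₂ s := measurable_id.mul measurable_symbDeriv₂
  rw [← Set.Ioc_union_Ioi_eq_Ioi zero_le_one]
  obtain ⟨C, hC⟩ := abs_symbDeriv₂_le_of_le_one
  obtain ⟨D, hD⟩ := abs_symbDeriv₂_le_of_one_le
  refine IntegrableOn.union ?_ ?_
  · refine Integrable.mono' (g := fun _ => C) (integrableOn_const (by simp))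
      hmeas.aestronglyMeasurable ?_
    filter_upwards [ae_restrict_mem measurableSet_Ioc] with s hs
    rw [Real.norm_eq_abs, abs_mul, abs_of_pos hs.1]
    exact (mul_le_of_le_one_left (abs_nonneg _) hs.2).trans (hC s hs.1 hs.2)
  · refine Integrable.mono' (g := fun s => D * s ^ (-3 / 2 : ℝ))
      ((integrableOn_Ioi_rpow_of_lt (by norm_num) one_pos).const_mul D)
      hmeas.aestronglyMeasurable ?_
    filter_upwards [ae_restrict_mem measurableSet_Ioi] with s hs
    exact hD s (le_of_lt hs)

theorem tendsto_symb_atTop : Tendsto symb atTop (𝓝 0) := by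
  have h : Tendsto (fun s => Real.tanh s / s) atTop (𝓝 0) := by
    refine squeeze_zero' ?_ ?_ (tendsto_inv_atTop_zero (𝕜 := ℝ))
    · filter_upwards [eventually_gt_atTop 0] with s hs using (div_pos (tanh_pos hs) hs).le
    · filter_upwards [eventually_gt_atTop 0] with s hs
      rw [← one_div]
      exact div_le_div_of_nonneg_right (Real.tanh_lt_one s).le hs.le
  have := h.sqrt
  rwa [Real.sqrt_zero] at this

theorem tendsto_mul_symbDeriv_atTop : Tendsto (fun s => s * symbDeriv s) atTop (𝓝 0) := by
  set c : ℝ := √(Real.tanh 1)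
  have hc : 0 < c := Real.sqrt_pos.2 (tanh_pos one_pos)
  have hlim : Tendsto (fun s : ℝ => (2 * c)⁻¹ * (√s)⁻¹) atTop (𝓝 0) := by
    have := (tendsto_inv_atTop_zero.comp Real.tendsto_sqrt_atTop).const_mul ((2 * c)⁻¹)
    rwa [mul_zero] at this
  refine squeeze_zero_norm' ?_ hlim
  filter_upwards [eventually_ge_atTop 1] with s hs
  have hs0 : 0 < s := by linarith
  have hr : 0 < √s := Real.sqrt_pos.2 hs0
  have hm := symb_pos hs0
  have h1 := abs_ratioDeriv_le hs0
  have h2 := le_symb_of_one_le hs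
  rw [Real.norm_eq_abs, abs_mul, abs_of_pos hs0, symbDeriv, abs_div,
    abs_of_pos (by positivity : 0 < 2 * symb s)]
  have h3 : |ratioDeriv s| / (2 * symb s) ≤ 1 / s ^ 2 / (2 * (c / √s)) :=
    div_le_div₀ (by positivity) h1 (by positivity) (by linarith)
  refine (mul_le_mul_of_nonneg_left h3 hs0.le).trans (le_of_eq ?_)
  have e2 : s = √s ^ 2 := (Real.sq_sqrt hs0.le).symm
  generalize √s = r at *
  subst e2
  field_simp

theorem whithamSymbol_eq_symb {ξ : ℝ} (hξ : ξ ≠ 0) : whithamSymbol ξ = symb |ξ| := by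
  rw [whithamSymbol, if_neg hξ, symb]
  rcases abs_choice ξ with h | h <;> rw [h]
  rw [Real.tanh_neg, neg_div_neg_eq]

theorem tendsto_whithamSymbol_zero : Tendsto whithamSymbol (𝓝[≠] 0) (𝓝 1) := by
  have h := (hasDerivAt_tanh 0).tendsto_slope_zero
  simp only [zero_add, Real.tanh_zero, sub_zero, ne_eq, OfNat.ofNat_ne_zero, not_false_eq_true,
    zero_pow, smul_eq_mul] at h
  have h2 := h.sqrt
  rw [Real.sqrt_one] at h2
  refine h2.congr' ?_
  filter_upwards [self_mem_nhdsWithin] with ξ hξ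
  rw [whithamSymbol, if_neg (show ξ ≠ 0 from hξ), inv_mul_eq_div]

theorem continuous_integral_mul_exp {K : ℝ → ℝ} (hK : Integrable K) :
    Continuous fun ξ : ℝ => ∫ x : ℝ, (K x : ℂ) * Complex.exp (-(Complex.I * x * ξ)) := by
  refine continuous_of_dominated (bound := fun x => ‖K x‖) (fun ξ => ?_) (fun ξ => ?_) hK.norm ?_
  · exact hK.ofReal.aestronglyMeasurable.mul (by fun_prop)
  · refine Eventually.of_forall fun x => ?_
    rw [norm_mul, norm_exp_neg_I_mul, mul_one, Complex.norm_real]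
  · exact Eventually.of_forall fun x => by fun_prop

/-- The superposition determines the transform only for `ξ ≠ 0`. At the origin the transform is
continuous and the symbol tends to `1`, the derivative of `tanh` at zero being `1`. -/
theorem exists_isWhithamKernel : ∃ K : ℝ → ℝ, IsWhithamKernel K := by
  obtain ⟨K, hK, hKξ⟩ := exists_integrable_fourier_eq (fun s => hasDerivAt_symb)
    (fun s => hasDerivAt_symbDeriv) integrableOn_mul_symbDeriv₂ tendsto_symb_atTop
    tendsto_mul_symbDeriv_atTop
  have h : ∀ ξ : ℝ, ξ ≠ 0 → ∫ x : ℝ, (K x : ℂ) * Complex.exp (-(Complex.I * x * ξ)) =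
      (whithamSymbol ξ : ℂ) := fun ξ hξ => by
    rw [hKξ ξ hξ, whithamSymbol_eq_symb hξ]
  refine ⟨K, hK, fun ξ => ?_⟩
  rcases eq_or_ne ξ 0 with rfl | hξ
  · have h1 := ((continuous_integral_mul_exp hK).tendsto 0).mono_left
      (nhdsWithin_le_nhds (s := {0}ᶜ))
    have h2 : Tendsto (fun ξ : ℝ => ∫ x : ℝ, (K x : ℂ) * Complex.exp (-(Complex.I * x * ξ)))
        (𝓝[≠] 0) (𝓝 ((1 : ℝ) : ℂ)) := by
      refine ((Complex.continuous_ofReal.tendsto 1).comp tendsto_whithamSymbol_zero).congr' ?_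
      filter_upwards [self_mem_nhdsWithin] with ξ hξ
      exact (h ξ hξ).symm
    rw [tendsto_nhds_unique h1 h2, whithamSymbol, if_pos rfl]
  · exact h ξ hξ

end WhithamKernel

variable {α : ℝ≥0}

/-! ### Analyticity and linearization common to both equations -/

section Formulation

theorem HolderEven.hasFDerivAt_neg_mul_self :
    HasFDerivAt (fun f : HolderEven α => -(f * f)) (0 : HolderEven α →L[ℝ] HolderEven α) 0 := by
  have h := (hasFDerivAt_mul_self (α := α)).neg
  rw [neg_zero] at h
  exact h

theorem analyticOnNhd_opF {L : ℝ → HolderEven α →L[ℝ] HolderEven α}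
    {N : HolderEven α × ℝ → HolderEven α} (hL : AnalyticOnNhd ℝ L (Set.Ioi 0))
    (hN : AnalyticOnNhd ℝ N {p | 0 < p.2}) : AnalyticOnNhd ℝ (opF L N) {p | 0 < p.2} := by
  intro p hp
  have hL' : AnalyticAt ℝ (fun q : HolderEven α × ℝ => L q.2) p := (hL p.2 hp).comp analyticAt_snd
  have h2 : AnalyticAt ℝ (fun q : HolderEven α × ℝ => L q.2 q.1) p :=
    ((ContinuousLinearMap.id ℝ (HolderEven α →L[ℝ] HolderEven α)).analyticAt_bilinear
      (L p.2, p.1)).comp₂ hL' analyticAt_fst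
  exact ((analyticAt_snd.smul analyticAt_fst).sub h2).add (hN p hp)

/-- The Fréchet derivative of `F` at `0` is `μ - L(μ)`, which is Fredholm of index zero. -/
theorem exists_fredholm_hasFDerivAt {L : ℝ → HolderEven α →L[ℝ] HolderEven α}
    {N : HolderEven α × ℝ → HolderEven α} {μ : ℝ} (hμ : 0 < μ)
    (hL : L μ ∈ (finiteRankOperators (HolderEven α)).topologicalClosure)
    (hN : HasFDerivAt (fun φ => N (φ, μ)) (0 : HolderEven α →L[ℝ] HolderEven α) 0) :
    ∃ A : HolderEven α →L[ℝ] HolderEven α,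
      HasFDerivAt (fun φ => opF L N (φ, μ)) A 0 ∧ IsFredholmIndexZero A := by
  refine ⟨μ • ContinuousLinearMap.id ℝ (HolderEven α) - L μ, ?_, isFredholm_smul_id_sub hμ hL⟩
  have h : HasFDerivAt (fun φ : HolderEven α => μ • φ - L μ φ + N (φ, μ))
      (μ • ContinuousLinearMap.id ℝ (HolderEven α) - L μ + 0) 0 :=
    (((hasFDerivAt_id (0 : HolderEven α)).const_smul μ).sub (L μ).hasFDerivAt).add hN
  rw [add_zero] at h
  exact h

end Formulation

/-! ### The Whitham equation -/

section WhithamEquation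

theorem whithamSymbol_neg (ξ : ℝ) : whithamSymbol (-ξ) = whithamSymbol ξ := by
  unfold whithamSymbol
  simp only [neg_eq_zero, Real.tanh_neg, neg_div_neg_eq]

instance : Fact (0 < 2 * Real.pi) := ⟨Real.two_pi_pos⟩

/-- The integral is a multiple of the difference of the transforms at `n` and `-n`, and the symbol
is even. No evenness of `K` itself is needed. -/
theorem IsWhithamKernel.integral_fourier {K : ℝ → ℝ} (hK : IsWhithamKernel K) (x : ℝ) (n : ℤ) :
    ∫ t : ℝ, (K t : ℂ) * (fourier n ((x - t : ℝ) : AddCircle (2 * Real.pi)) -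
      fourier n ((x + t : ℝ) : AddCircle (2 * Real.pi))) = 0 := by
  have hπ : (Real.pi : ℂ) ≠ 0 := Complex.ofReal_ne_zero.2 Real.pi_ne_zero
  have e : ∀ t : ℝ, (K t : ℂ) * (fourier n ((x - t : ℝ) : AddCircle (2 * Real.pi)) -
      fourier n ((x + t : ℝ) : AddCircle (2 * Real.pi))) =
      Complex.exp (Complex.I * n * x) *
        ((K t : ℂ) * Complex.exp (-(Complex.I * t * (n : ℝ))) -
          (K t : ℂ) * Complex.exp (-(Complex.I * t * ((-n : ℝ) : ℂ)))) := by
    intro t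
    have e1 : 2 * (Real.pi : ℂ) * Complex.I * n * ((x - t : ℝ) : ℂ) / ((2 * Real.pi : ℝ) : ℂ) =
        Complex.I * n * x + -(Complex.I * t * (n : ℝ)) := by
      push_cast
      field_simp
      ring
    have e2 : 2 * (Real.pi : ℂ) * Complex.I * n * ((x + t : ℝ) : ℂ) / ((2 * Real.pi : ℝ) : ℂ) =
        Complex.I * n * x + -(Complex.I * t * ((-n : ℝ) : ℂ)) := by
      push_cast
      field_simp
    rw [fourier_coe_apply, fourier_coe_apply, e1, e2, Complex.exp_add, Complex.exp_add]
    ring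
  have hi : ∀ ξ : ℝ, Integrable fun t : ℝ => (K t : ℂ) * Complex.exp (-(Complex.I * t * ξ)) :=
    fun ξ => hK.1.ofReal.mul_bdd (c := 1) (by fun_prop)
      (Eventually.of_forall fun t => (norm_exp_neg_I_mul t ξ).le)
  simp only [e]
  rw [integral_const_mul, integral_sub (hi _) (hi _), hK.2, hK.2, whithamSymbol_neg, sub_self,
    mul_zero]

/-- The odd part of a Whitham kernel is not seen by continuous periodic functions. -/
theorem IsWhithamKernel.integral_continuousMap {K : ℝ → ℝ} (hK : IsWhithamKernel K) (x : ℝ)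
    (G : C(AddCircle (2 * Real.pi), ℂ)) :
    ∫ t : ℝ, (K t : ℂ) * (G ((x - t : ℝ) : AddCircle (2 * Real.pi)) -
      G ((x + t : ℝ) : AddCircle (2 * Real.pi))) = 0 := by
  have hb : ∀ (G : C(AddCircle (2 * Real.pi), ℂ)) (t : ℝ),
      ‖G ((x - t : ℝ) : AddCircle (2 * Real.pi)) -
        G ((x + t : ℝ) : AddCircle (2 * Real.pi))‖ ≤ 2 * ‖G‖ := fun G t => by
    refine (norm_sub_le _ _).trans ?_
    linarith [G.norm_coe_le_norm ((x - t : ℝ) : AddCircle (2 * Real.pi)),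
      G.norm_coe_le_norm ((x + t : ℝ) : AddCircle (2 * Real.pi))]
  have hc : ∀ G : C(AddCircle (2 * Real.pi), ℂ), Continuous fun t : ℝ =>
      G ((x - t : ℝ) : AddCircle (2 * Real.pi)) - G ((x + t : ℝ) : AddCircle (2 * Real.pi)) :=
    fun G => (G.continuous.comp ((AddCircle.continuous_mk' _).comp (by fun_prop))).sub
      (G.continuous.comp ((AddCircle.continuous_mk' _).comp (by fun_prop)))
  have hi : ∀ G : C(AddCircle (2 * Real.pi), ℂ), Integrable fun t : ℝ =>
      (K t : ℂ) * (G ((x - t : ℝ) : AddCircle (2 * Real.pi)) -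
        G ((x + t : ℝ) : AddCircle (2 * Real.pi))) := fun G =>
    hK.1.ofReal.mul_bdd (c := 2 * ‖G‖) (hc G).aestronglyMeasurable (Eventually.of_forall (hb G))
  -- A continuous functional that vanishes on the exponentials vanishes on the closure of their
  -- span, which is everything.
  let Ψ : C(AddCircle (2 * Real.pi), ℂ) →L[ℂ] ℂ := LinearMap.mkContinuous
    { toFun := fun G => ∫ t : ℝ, (K t : ℂ) * (G ((x - t : ℝ) : AddCircle (2 * Real.pi)) -
        G ((x + t : ℝ) : AddCircle (2 * Real.pi)))
      map_add' := fun G H => by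
        rw [← integral_add (hi G) (hi H)]
        congr 1 with t
        simp only [ContinuousMap.add_apply]
        ring
      map_smul' := fun c G => by
        rw [RingHom.id_apply, smul_eq_mul, ← integral_const_mul]
        congr 1 with t
        simp only [ContinuousMap.smul_apply, smul_eq_mul]
        ring } ((∫ t, ‖(K t : ℂ)‖) * 2) fun G => by
      rw [mul_assoc, ← integral_mul_const]
      refine norm_integral_le_of_norm_le (hK.1.ofReal.norm.mul_const _)
        (Eventually.of_forall fun t => ?_)
      rw [norm_mul]
      exact mul_le_mul_of_nonneg_left (hb G t) (norm_nonneg _)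
  have hle : (Submodule.span ℂ (Set.range (@fourier (2 * Real.pi)))).topologicalClosure ≤
      Ψ.ker := by
    refine Submodule.topologicalClosure_minimal _ (Submodule.span_le.2 ?_) Ψ.isClosed_ker
    rintro _ ⟨n, rfl⟩
    exact hK.integral_fourier x n
  rw [span_fourier_closure_eq_top] at hle
  exact hle (Submodule.mem_top (x := G))

theorem IsWhithamKernel.integral_sub_eq_integral_add {K : ℝ → ℝ} (hK : IsWhithamKernel K)
    (hα : 0 < α) (f : HolderEven α) (x : ℝ) :
    ∫ t, K t * f (x - t) = ∫ t, K t * f (x + t) := by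
  let G : C(AddCircle (2 * Real.pi), ℂ) :=
    ⟨fun y => ((f.periodic.lift y : ℝ) : ℂ), Complex.continuous_ofReal.comp
      (continuous_coinduced_dom.2 (f.continuous hα))⟩
  have h := hK.integral_continuousMap x G
  have e : ∀ t : ℝ, (K t : ℂ) * (G ((x - t : ℝ) : AddCircle (2 * Real.pi)) -
      G ((x + t : ℝ) : AddCircle (2 * Real.pi))) =
      ((K t * f (x - t) - K t * f (x + t) : ℝ) : ℂ) := by
    intro t
    have e1 : ∀ y : ℝ, G (y : AddCircle (2 * Real.pi)) = (f y : ℂ) := fun y => by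
      simp only [G, ContinuousMap.coe_mk, Function.Periodic.lift_coe]
    rw [e1, e1]
    push_cast
    ring
  simp only [e] at h
  rw [integral_complex_ofReal, Complex.ofReal_eq_zero, integral_sub
    (HolderEven.integrable_mul hα hK.1 f (by fun_prop))
    (HolderEven.integrable_mul hα hK.1 f (by fun_prop))] at h
  exact sub_eq_zero.1 h

theorem IsWhithamKernel.isFormulation {K : ℝ → ℝ} (hK : IsWhithamKernel K) (hα : 0 < α) :
    IsFormulation (IsWhithamSolution K) (fun _ => HolderEven.evenConv hα K hK.1)
      (fun p => -(p.1 * p.1)) where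
  compact μ _ := isCompactOperator_of_mem_closure (HolderEven.evenConv_mem_closure hα hK.1)
  analytic := analyticOnNhd_opF analyticOnNhd_const fun p _ =>
    ((HolderEven.analyticOnNhd_mul_self Set.univ p.1 trivial).comp analyticAt_fst).neg
  solution_iff φ μ _ := by
    have hx : ∀ x, opF (fun _ => HolderEven.evenConv hα K hK.1) (fun p => -(p.1 * p.1)) (φ, μ) x =
        -(-μ * φ x + φ x ^ 2 + (K ⋆ φ) x) := by
      intro x
      rw [HolderEven.convolution_eq_evenConv hα hK.1 φ x
        (hK.integral_sub_eq_integral_add hα φ x)]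
      change μ * φ x - HolderEven.evenConv hα K hK.1 φ x + -(φ x * φ x) = _
      ring
    constructor
    · intro h
      exact HolderEven.ext fun x => by rw [hx, h x, neg_zero, HolderEven.zero_apply]
    · intro h x
      have := hx x
      rw [h, HolderEven.zero_apply] at this
      linarith
  deriv_N μ _ := HolderEven.hasFDerivAt_neg_mul_self
  fredholm μ hμ := exists_fredholm_hasFDerivAt hμ (HolderEven.evenConv_mem_closure hα hK.1)
    HolderEven.hasFDerivAt_neg_mul_self

end WhithamEquation

/-! ### The resolvent of the second derivative and uniqueness of periodic solutions -/

section Resolvent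

theorem hasDerivAt_integral_Iic {h : ℝ → ℝ} (hc : Continuous h)
    (hi : ∀ b, IntegrableOn h (Set.Iic b)) (x : ℝ) :
    HasDerivAt (fun x => ∫ y in Set.Iic x, h y) (h x) x := by
  have e : (fun x => ∫ y in Set.Iic x, h y) =
      fun x => (∫ y in Set.Iic (0 : ℝ), h y) + ∫ y in (0 : ℝ)..x, h y := funext fun x => by
    rw [← intervalIntegral.integral_Iic_sub_Iic (hi 0) (hi x)]
    ring
  rw [e]
  exact ((hc.integral_hasStrictDerivAt 0 x).hasDerivAt).const_add _

theorem hasDerivAt_integral_Ioi {h : ℝ → ℝ} (hc : Continuous h)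
    (hi : ∀ b, IntegrableOn h (Set.Ioi b)) (x : ℝ) :
    HasDerivAt (fun x => ∫ y in Set.Ioi x, h y) (-h x) x := by
  have e : (fun x => ∫ y in Set.Ioi x, h y) =
      fun x => (∫ y in Set.Ioi (0 : ℝ), h y) - ∫ y in (0 : ℝ)..x, h y := funext fun x => by
    rw [← intervalIntegral.integral_Ioi_sub_Ioi' (hi 0) (hi x)]
    ring
  rw [e]
  exact ((hc.integral_hasStrictDerivAt 0 x).hasDerivAt).const_sub _

theorem resolventKernel_neg (τ x : ℝ) : resolventKernel τ (-x) = resolventKernel τ x := by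
  simp only [resolventKernel, abs_neg]

theorem resolventKernel_of_nonneg (τ : ℝ) {x : ℝ} (hx : 0 ≤ x) :
    resolventKernel τ x = 1 / (2 * τ) * Real.exp (-τ⁻¹ * x) := by
  rw [resolventKernel, abs_of_nonneg hx]
  ring_nf

theorem resolventKernel_of_nonpos (τ : ℝ) {x : ℝ} (hx : x ≤ 0) :
    resolventKernel τ x = 1 / (2 * τ) * Real.exp (τ⁻¹ * x) := by
  rw [resolventKernel, abs_of_nonpos hx]
  ring_nf

theorem integrable_resolventKernel {τ : ℝ} (hτ : 0 < τ) : Integrable (resolventKernel τ) := by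
  have hτ' : 0 < τ⁻¹ := inv_pos.2 hτ
  rw [← integrableOn_univ, ← Set.Iic_union_Ioi (a := (0 : ℝ))]
  refine IntegrableOn.union ?_ ?_
  · refine IntegrableOn.congr_fun ((integrableOn_exp_mul_Iic hτ' 0).const_mul (1 / (2 * τ)))
      (fun x hx => (resolventKernel_of_nonpos τ hx).symm) measurableSet_Iic
  · refine IntegrableOn.congr_fun
      ((integrableOn_exp_mul_Ioi (neg_lt_zero.2 hτ') 0).const_mul (1 / (2 * τ)))
      (fun x hx => (resolventKernel_of_nonneg τ (le_of_lt hx)).symm) measurableSet_Ioi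

/-- The function `u = k ⋆ f`, with `k` the resolvent kernel, solves `u - τ² u'' = f`. -/
theorem exists_hasDerivAt_resolvent {τ : ℝ} (hτ : 0 < τ) {f : ℝ → ℝ} (hf : Continuous f) {M : ℝ}
    (hM : ∀ x, |f x| ≤ M) :
    ∃ u' : ℝ → ℝ, (∀ x, HasDerivAt (resolventKernel τ ⋆ f) (u' x) x) ∧
      ∀ x, HasDerivAt u' (((resolventKernel τ ⋆ f) x - f x) / τ ^ 2) x := by
  have hτ' : 0 < τ⁻¹ := inv_pos.2 hτ
  set c : ℝ := τ⁻¹ with hc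
  have hleft : ∀ b, IntegrableOn (fun y => Real.exp (c * y) * f y) (Set.Iic b) := fun b =>
    Integrable.mul_bdd (c := M) (integrableOn_exp_mul_Iic hτ' b) hf.aestronglyMeasurable
      (Eventually.of_forall hM)
  have hright : ∀ b, IntegrableOn (fun y => Real.exp (-c * y) * f y) (Set.Ioi b) := fun b =>
    Integrable.mul_bdd (c := M) (integrableOn_exp_mul_Ioi (neg_lt_zero.2 hτ') b)
      hf.aestronglyMeasurable (Eventually.of_forall hM)
  -- Splitting the convolution at `x` removes the absolute value. The terms from differentiating `A`
  -- and `B` cancel in the first derivative and add up to `-c² f` in the second.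
  let A : ℝ → ℝ := fun x => ∫ y in Set.Iic x, Real.exp (c * y) * f y
  let B : ℝ → ℝ := fun x => ∫ y in Set.Ioi x, Real.exp (-c * y) * f y
  have hA : ∀ x, HasDerivAt A (Real.exp (c * x) * f x) x :=
    hasDerivAt_integral_Iic (by fun_prop) hleft
  have hB : ∀ x, HasDerivAt B (-(Real.exp (-c * x) * f x)) x :=
    hasDerivAt_integral_Ioi (by fun_prop) hright
  have hu : resolventKernel τ ⋆ f =
      fun x => c / 2 * (Real.exp (-c * x) * A x + Real.exp (c * x) * B x) := by
    funext x
    have hint : Integrable fun y => resolventKernel τ (x - y) * f y :=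
      ((integrable_resolventKernel hτ).comp_sub_left x).mul_bdd (c := M) hf.aestronglyMeasurable
        (Eventually.of_forall hM)
    have h1 : (resolventKernel τ ⋆ f) x = ∫ y, resolventKernel τ (x - y) * f y := by
      rw [← integral_sub_left_eq_self (fun y => resolventKernel τ (x - y) * f y) volume x]
      simp only [sub_sub_cancel]
      rfl
    have h2 : ∫ y in Set.Iic x, resolventKernel τ (x - y) * f y =
        c / 2 * Real.exp (-c * x) * A x := by
      rw [← integral_const_mul]
      refine setIntegral_congr_fun measurableSet_Iic fun y hy => ?_
      have e : Real.exp (-c * (x - y)) = Real.exp (-c * x) * Real.exp (c * y) := by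
        rw [← Real.exp_add]; ring_nf
      simp only [resolventKernel_of_nonneg τ (sub_nonneg.2 hy), ← hc, e]
      rw [hc]
      field_simp
    have h3 : ∫ y in Set.Ioi x, resolventKernel τ (x - y) * f y =
        c / 2 * Real.exp (c * x) * B x := by
      rw [← integral_const_mul]
      refine setIntegral_congr_fun measurableSet_Ioi fun y hy => ?_
      have e : Real.exp (c * (x - y)) = Real.exp (c * x) * Real.exp (-c * y) := by
        rw [← Real.exp_add]; ring_nf
      simp only [resolventKernel_of_nonpos τ (sub_nonpos.2 (le_of_lt hy)), ← hc, e]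
      rw [hc]
      field_simp
    rw [h1, ← intervalIntegral.integral_Iic_add_Ioi hint.integrableOn hint.integrableOn, h2, h3]
    ring
  have hexp : ∀ a x : ℝ, HasDerivAt (fun x => Real.exp (a * x)) (a * Real.exp (a * x)) x := by
    intro a x
    have h1 : HasDerivAt (fun x => a * x) a x := by simpa using (hasDerivAt_id x).const_mul a
    refine h1.exp.congr_deriv (by ring)
  have hmul : ∀ x, Real.exp (-c * x) * Real.exp (c * x) = 1 := fun x => by
    rw [← Real.exp_add]; simp
  rw [hu]
  refine ⟨fun x => c ^ 2 / 2 * (Real.exp (c * x) * B x - Real.exp (-c * x) * A x),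
    fun x => ?_, fun x => ?_⟩
  · refine ((((hexp (-c) x).mul (hA x)).add ((hexp c x).mul (hB x))).const_mul
      (c / 2)).congr_deriv ?_
    ring
  · refine ((((hexp c x).mul (hB x)).sub ((hexp (-c) x).mul (hA x))).const_mul
      (c ^ 2 / 2)).congr_deriv ?_
    have e : ∀ z : ℝ, z / τ ^ 2 = c ^ 2 * z := fun z => by rw [hc]; field_simp
    rw [e]
    linear_combination (-c ^ 2 * f x) * hmul x

theorem contDiff_two_of_hasDerivAt {u u' u'' : ℝ → ℝ} (h : ∀ x, HasDerivAt u (u' x) x)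
    (h' : ∀ x, HasDerivAt u' (u'' x) x) (hc : Continuous u'') :
    ContDiff ℝ 2 u ∧ iteratedDeriv 2 u = u'' := by
  have e1 : deriv u = u' := funext fun x => (h x).deriv
  have e2 : deriv u' = u'' := funext fun x => (h' x).deriv
  constructor
  · rw [show (2 : WithTop ℕ∞) = 1 + 1 by norm_num, contDiff_succ_iff_deriv, e1]
    refine ⟨fun x => (h x).differentiableAt, by simp, contDiff_one_iff_deriv.2
      ⟨fun x => (h' x).differentiableAt, ?_⟩⟩
    rwa [e2]
  · rw [iteratedDeriv_succ, iteratedDeriv_one, e1, e2]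

theorem hasDerivAt_of_contDiff_two {u : ℝ → ℝ} (h : ContDiff ℝ 2 u) :
    (∀ x, HasDerivAt u (deriv u x) x) ∧
      (∀ x, HasDerivAt (deriv u) (iteratedDeriv 2 u x) x) ∧ Continuous (iteratedDeriv 2 u) := by
  refine ⟨fun x => (h.differentiable (by norm_num) x).hasDerivAt, fun x => ?_,
    h.continuous_iteratedDeriv 2 le_rfl⟩
  have h1 : ContDiff ℝ 1 (deriv u) := by
    have h2 : ContDiff ℝ (1 + 1) u := by norm_num; exact h
    exact (contDiff_succ_iff_deriv.1 h2).2.2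
  rw [iteratedDeriv_succ, iteratedDeriv_one]
  exact (h1.differentiable one_ne_zero x).hasDerivAt

/-- The function `z x * exp (-c x)` is constant, while a period multiplies the exponential by a
factor different from `1`. -/
theorem eq_zero_of_periodic_of_deriv_eq_mul {T c : ℝ} (hT : 0 < T) (hc : c ≠ 0) {z : ℝ → ℝ}
    (hz : Function.Periodic z T) (h : ∀ x, HasDerivAt z (c * z x) x) (x : ℝ) : z x = 0 := by
  have hd : ∀ x, HasDerivAt (fun x => z x * Real.exp (-c * x)) 0 x := by
    intro x
    have h1 : HasDerivAt (fun x => -c * x) (-c) x := by simpa using (hasDerivAt_id x).const_mul (-c)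
    refine ((h x).mul h1.exp).congr_deriv (by ring)
  have hconst := is_const_of_deriv_eq_zero (fun x => (hd x).differentiableAt)
    (fun x => (hd x).deriv) (x + T) x
  simp only [hz x] at hconst
  by_contra hx
  have h2 := mul_left_cancel₀ hx hconst
  rw [Real.exp_eq_exp] at h2
  have h3 : c * T = 0 := by linarith
  exact (mul_ne_zero hc hT.ne') h3

/-- The only periodic solution of `w'' = c² w` is zero. -/
theorem eq_zero_of_periodic_of_deriv₂_eq {T c : ℝ} (hT : 0 < T) (hc : c ≠ 0) {w w' : ℝ → ℝ}
    (hw : Function.Periodic w T) (h : ∀ x, HasDerivAt w (w' x) x)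
    (h' : ∀ x, HasDerivAt w' (c ^ 2 * w x) x) (x : ℝ) : w x = 0 := by
  have hw' : Function.Periodic w' T := fun x => by
    have h1 : HasDerivAt (fun x => w (x + T)) (w' (x + T)) x := (h (x + T)).comp_add_const x T
    rw [funext hw] at h1
    exact h1.unique (h x)
  -- The equation factors as `(∂ - c)(∂ + c) w = 0`, and each first-order factor has only the zero
  -- periodic solution.
  have h1 : ∀ x, w' x + c * w x = 0 :=
    eq_zero_of_periodic_of_deriv_eq_mul hT hc (z := fun x => w' x + c * w x)
      (fun x => by simp only [hw x, hw' x])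
      fun x => ((h' x).add ((h x).const_mul c)).congr_deriv (by ring)
  refine eq_zero_of_periodic_of_deriv_eq_mul hT (neg_ne_zero.2 hc) hw (fun x => ?_) x
  exact (h x).congr_deriv (by linarith [h1 x])

theorem integral_mul_deriv₂ {v v' v'' ψ : ℝ → ℝ} (h : ∀ x, HasDerivAt v (v' x) x)
    (h' : ∀ x, HasDerivAt v' (v'' x) x) (hc : Continuous v'') (hψ : ContDiff ℝ ∞ ψ)
    (hs : HasCompactSupport ψ) :
    ∫ x, v x * iteratedDeriv 2 ψ x = ∫ x, v'' x * ψ x := by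
  have hψ2 : ContDiff ℝ 2 ψ := by exact_mod_cast contDiff_infty.1 hψ 2
  obtain ⟨d1, d2, c2⟩ := hasDerivAt_of_contDiff_two hψ2
  have hv : Continuous v := continuous_iff_continuousAt.2 fun x => (h x).continuousAt
  have hv' : Continuous v' := continuous_iff_continuousAt.2 fun x => (h' x).continuousAt
  have c1 : Continuous (deriv ψ) := continuous_iff_continuousAt.2 fun x => (d2 x).continuousAt
  have s1 : HasCompactSupport (deriv ψ) := hs.deriv
  have s2 : HasCompactSupport (iteratedDeriv 2 ψ) := by
    rw [iteratedDeriv_succ, iteratedDeriv_one]; exact s1.deriv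
  have hint : ∀ {f g : ℝ → ℝ}, Continuous f → Continuous g → HasCompactSupport g →
      Integrable (f * g) := fun hf hg hs =>
    (hf.mul hg).integrable_of_hasCompactSupport hs.mul_left
  rw [integral_mul_deriv_eq_deriv_mul_of_integrable (fun x _ => h x) (fun x _ => d2 x)
    (hint hv c2 s2) (hint hv' c1 s1) (hint hv c1 s1),
    integral_mul_deriv_eq_deriv_mul_of_integrable (fun x _ => h' x) (fun x _ => d1 x)
    (hint hv' c1 s1) (hint hc hψ.continuous hs) (hint hv' hψ.continuous hs), neg_neg]

/-- A continuous periodic function which solves `w'' = c² w` in the sense of distributions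
vanishes. -/
theorem eq_zero_of_periodic_of_distributional {T c : ℝ} (hT : 0 < T) (hc : c ≠ 0) {w : ℝ → ℝ}
    (hw : Continuous w) (hp : Function.Periodic w T)
    (h : ∀ ψ : ℝ → ℝ, ContDiff ℝ ∞ ψ → HasCompactSupport ψ →
      ∫ x, w x * iteratedDeriv 2 ψ x = c ^ 2 * ∫ x, w x * ψ x) (x : ℝ) : w x = 0 := by
  -- Mollifications of `w` are periodic and solve the equation classically, the test function being
  -- `y ↦ r (x - y)`. They therefore vanish, and so does their limit `w`.
  have hmoll : ∀ (ρ : ContDiffBump (0 : ℝ)) (x : ℝ), (ρ.normed volume ⋆ w) x = 0 := by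
    intro ρ
    set r : ℝ → ℝ := ρ.normed volume with hr
    have hrs : HasCompactSupport r := ρ.hasCompactSupport_normed
    have hrc : ContDiff ℝ ∞ r := ρ.contDiff_normed (n := ⊤)
    have hr2 : ContDiff ℝ 2 r := by exact_mod_cast contDiff_infty.1 hrc 2
    obtain ⟨d1, d2, c2⟩ := hasDerivAt_of_contDiff_two hr2
    have hr1 : ContDiff ℝ 1 (deriv r) := by
      have h2 : ContDiff ℝ (1 + 1) r := by norm_num; exact hr2
      exact (contDiff_succ_iff_deriv.1 h2).2.2
    have hswap : ∀ (g : ℝ → ℝ) (x : ℝ), (g ⋆ w) x = ∫ y, w y * g (x - y) := by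
      intro g x
      rw [← integral_sub_left_eq_self (fun y => w y * g (x - y)) volume x]
      simp only [sub_sub_cancel]
      refine integral_congr_ae (Eventually.of_forall fun t => ?_)
      simp only [ContinuousLinearMap.lsmul_apply, smul_eq_mul]
      ring
    refine eq_zero_of_periodic_of_deriv₂_eq hT hc (w' := deriv r ⋆ w) ?_ (fun x =>
      hrs.hasDerivAt_convolution_left _ (hr2.of_le (by norm_num))
        hw.locallyIntegrable x) fun x => ?_
    · intro x
      refine integral_congr_ae (Eventually.of_forall fun t => ?_)
      simp only [add_sub_right_comm, hp (x - t)]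
    · refine (hrs.deriv.hasDerivAt_convolution_left _ hr1
        hw.locallyIntegrable x).congr_deriv ?_
      rw [hswap, hswap]
      have hψ : ∀ y, iteratedDeriv 2 (fun y => r (x - y)) y = deriv (deriv r) (x - y) := by
        have e1 : ∀ y, HasDerivAt (fun y => r (x - y)) (-deriv r (x - y)) y := fun y =>
          (d1 (x - y)).comp_const_sub x y
        have e2 : ∀ y, HasDerivAt (fun y => -deriv r (x - y)) (deriv (deriv r) (x - y)) y :=
          fun y => by
            have := ((d2 (x - y)).comp_const_sub x y).neg
            rw [iteratedDeriv_succ, iteratedDeriv_one, neg_neg] at this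
            exact this
        have hcont : Continuous fun y => deriv (deriv r) (x - y) := by
          rw [iteratedDeriv_succ, iteratedDeriv_one] at c2
          fun_prop
        exact fun y => congrFun (contDiff_two_of_hasDerivAt e1 e2 hcont).2 y
      rw [← h (fun y => r (x - y)) (hrc.comp (contDiff_const.sub contDiff_id))
        (hrs.comp_homeomorph (Homeomorph.subLeft x))]
      simp only [hψ]
  let φ : ℕ → ContDiffBump (0 : ℝ) := fun n =>
    ⟨1 / ((n : ℝ) + 1) / 2, 1 / ((n : ℝ) + 1), by positivity, half_lt_self (by positivity)⟩
  have hlim := ContDiffBump.convolution_tendsto_right_of_continuous (μ := volume) (φ := φ)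
    (l := atTop) tendsto_one_div_add_atTop_nhds_zero_nat hw x
  refine tendsto_nhds_unique hlim ?_
  have e : ∀ n, ((φ n).normed volume ⋆ w) x = 0 := fun n => hmoll (φ n) x
  exact tendsto_const_nhds.congr fun n => (e n).symm

end Resolvent

/-! ### The KdV equation -/

section KdV

theorem resolventWidth_pos {μ : ℝ} (hμ : 0 < μ) : 0 < 1 / √(6 * μ) := by positivity

open scoped Classical in
/-- The operator `(1 - (6μ)⁻¹ ∂ₓ²)⁻¹` for `μ > 0`. -/
noncomputable def kdvOp (hα : 0 < α) (μ : ℝ) : HolderEven α →L[ℝ] HolderEven α :=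
  if hμ : 0 < μ then
    HolderEven.evenConv hα _ (integrable_resolventKernel (resolventWidth_pos hμ))
  else 0

theorem kdvOp_of_pos (hα : 0 < α) {μ : ℝ} (hμ : 0 < μ) : kdvOp hα μ =
    HolderEven.evenConv hα _ (integrable_resolventKernel (resolventWidth_pos hμ)) :=
  dif_pos hμ

theorem kdvOp_apply (hα : 0 < α) {μ : ℝ} (hμ : 0 < μ) (f : HolderEven α) (x : ℝ) :
    kdvOp hα μ f x = (resolventKernel (1 / √(6 * μ)) ⋆ f) x := by
  rw [kdvOp_of_pos hα hμ, HolderEven.convolution_eq_evenConv hα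
    (integrable_resolventKernel (resolventWidth_pos hμ))]
  rw [← integral_neg_eq_self]
  simp only [resolventKernel_neg, sub_neg_eq_add]

theorem kdvOp_mem_closure (hα : 0 < α) {μ : ℝ} (hμ : 0 < μ) :
    kdvOp hα μ ∈ (finiteRankOperators (HolderEven α)).topologicalClosure := by
  rw [kdvOp_of_pos hα hμ]
  exact HolderEven.evenConv_mem_closure hα _

theorem exists_hasDerivAt_kdvOp (hα : 0 < α) {μ : ℝ} (hμ : 0 < μ) (f : HolderEven α) :
    ∃ u' : ℝ → ℝ, (∀ x, HasDerivAt (kdvOp hα μ f) (u' x) x) ∧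
      ∀ x, HasDerivAt u' (6 * μ * (kdvOp hα μ f x - f x)) x := by
  obtain ⟨u', h1, h2⟩ := exists_hasDerivAt_resolvent (resolventWidth_pos hμ) (f.continuous hα)
    f.abs_le_supNorm
  have e : ⇑(kdvOp hα μ f) = resolventKernel (1 / √(6 * μ)) ⋆ f := funext (kdvOp_apply hα hμ f)
  rw [e]
  refine ⟨u', h1, fun x => (h2 x).congr_deriv ?_⟩
  rw [div_pow, one_pow, Real.sq_sqrt (by positivity)]
  field_simp

theorem contDiff_kdvOp (hα : 0 < α) {μ : ℝ} (hμ : 0 < μ) (f : HolderEven α) :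
    ContDiff ℝ 2 (kdvOp hα μ f) ∧
      ∀ x, iteratedDeriv 2 (kdvOp hα μ f) x = 6 * μ * (kdvOp hα μ f x - f x) := by
  obtain ⟨u', h1, h2⟩ := exists_hasDerivAt_kdvOp hα hμ f
  have hc1 := (kdvOp hα μ f).continuous hα
  have hc2 := f.continuous hα
  obtain ⟨h3, h4⟩ := contDiff_two_of_hasDerivAt h1 h2 (by fun_prop)
  exact ⟨h3, fun x => congrFun h4 x⟩

/-- Uniqueness of the periodic solution of `v - (6μ)⁻¹ v'' = f`. -/
theorem eq_kdvOp_of_hasDerivAt (hα : 0 < α) {μ : ℝ} (hμ : 0 < μ) {v f : HolderEven α}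
    {v' : ℝ → ℝ} (h : ∀ x, HasDerivAt v (v' x) x)
    (h' : ∀ x, HasDerivAt v' (6 * μ * (v x - f x)) x) : v = kdvOp hα μ f := by
  obtain ⟨u', h1, h2⟩ := exists_hasDerivAt_kdvOp hα hμ f
  have hper : Function.Periodic (fun x => v x - kdvOp hα μ f x) (2 * Real.pi) := fun x => by
    simp only [v.periodic x, (kdvOp hα μ f).periodic x]
  refine HolderEven.ext fun x => sub_eq_zero.1 ?_
  refine eq_zero_of_periodic_of_deriv₂_eq Real.two_pi_pos
    (Real.sqrt_pos.2 (by positivity : 0 < 6 * μ)).ne' hper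
    (fun x => (h x).sub (h1 x)) (fun x => ((h' x).sub (h2 x)).congr_deriv ?_) x
  rw [Real.sq_sqrt (by positivity)]
  ring

/-- The resolvent identity. -/
theorem kdvOp_resolvent (hα : 0 < α) {μ ν : ℝ} (hμ : 0 < μ) (hν : 0 < ν) :
    (1 - (1 - ν / μ) • kdvOp hα μ) * kdvOp hα ν = (ν / μ) • kdvOp hα μ := by
  ext f
  obtain ⟨u', h1, h2⟩ := exists_hasDerivAt_kdvOp hα hν f
  -- For `u = L(ν) f`, the equation `u'' = 6ν (u - f)` is also `u'' = 6μ (u - h)` with `h = (ν/μ) f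
  -- + (1 - ν/μ) u`.
  have h := eq_kdvOp_of_hasDerivAt hα hμ
    (f := (ν / μ) • f + (1 - ν / μ) • kdvOp hα ν f) h1 fun x => (h2 x).congr_deriv (by
      rw [HolderEven.add_apply, HolderEven.smul_apply, HolderEven.smul_apply]
      field_simp
      ring)
  rw [map_add, map_smul, map_smul] at h
  change kdvOp hα ν f - (1 - ν / μ) • kdvOp hα μ (kdvOp hα ν f) = (ν / μ) • kdvOp hα μ f
  nth_rewrite 1 [h]
  abel

/-- Near `μ` the resolvent identity gives `L(ν) = g(ν)⁻¹ (ν/μ) L(μ)` with `g` affine in `ν` and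
`g(μ) = 1`, and inversion is analytic near a unit. -/
theorem analyticOnNhd_kdvOp (hα : 0 < α) : AnalyticOnNhd ℝ (kdvOp hα) (Set.Ioi 0) := by
  intro μ hμ
  have hμ' : 0 < μ := hμ
  let g : ℝ → HolderEven α →L[ℝ] HolderEven α := fun ν => 1 - (1 - ν / μ) • kdvOp hα μ
  have hdiv : AnalyticAt ℝ (fun ν : ℝ => ν / μ) μ := analyticAt_id.div_const
  have hg : AnalyticAt ℝ g μ :=
    analyticAt_const.sub ((analyticAt_const.sub hdiv).smul analyticAt_const)
  have hgμ : g μ = 1 := by simp [g, hμ'.ne']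
  have hinv : AnalyticAt ℝ (fun ν => Ring.inverse (g ν)) μ := by
    have h1 : AnalyticAt ℝ (Ring.inverse : (HolderEven α →L[ℝ] HolderEven α) → _) (g μ) := by
      rw [hgμ]
      exact analyticAt_inverse (𝕜 := ℝ) (1 : (HolderEven α →L[ℝ] HolderEven α)ˣ)
    exact h1.comp hg
  have hmain : AnalyticAt ℝ (fun ν => Ring.inverse (g ν) * ((ν / μ) • kdvOp hα μ)) μ :=
    hinv.mul (hdiv.smul analyticAt_const)
  refine hmain.congr ?_
  have hunit : ∀ᶠ ν in 𝓝 μ, IsUnit (g ν) := by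
    refine hg.continuousAt.eventually ?_
    rw [hgμ]
    exact Units.nhds (1 : (HolderEven α →L[ℝ] HolderEven α)ˣ)
  filter_upwards [hunit, lt_mem_nhds hμ'] with ν hν hν0
  rw [← kdvOp_resolvent hα hμ' hν0]
  exact Ring.inverse_mul_cancel_left _ _ hν

/-- The fixed-point form is the common intermediate to which classical and distributional solutions
are compared. -/
theorem opF_kdv_eq_zero_iff (hα : 0 < α) {μ : ℝ} (hμ : 0 < μ) (φ : HolderEven α) :
    opF (kdvOp hα) (fun p => -(kdvOp hα p.2 (p.1 * p.1))) (φ, μ) = 0 ↔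
      φ = kdvOp hα μ (μ⁻¹ • (φ + φ * φ)) := by
  have e : opF (kdvOp hα) (fun p => -(kdvOp hα p.2 (p.1 * p.1))) (φ, μ) =
      μ • (φ - kdvOp hα μ (μ⁻¹ • (φ + φ * φ))) := by
    rw [map_smul, map_add, smul_sub, smul_inv_smul₀ hμ.ne']
    change μ • φ - kdvOp hα μ φ + -kdvOp hα μ (φ * φ) = _
    abel
  rw [e, smul_eq_zero, or_iff_right hμ.ne', sub_eq_zero]

theorem isClassicalKdVSolution_iff (hα : 0 < α) {μ : ℝ} (hμ : 0 < μ) (φ : HolderEven α) :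
    IsClassicalKdVSolution μ φ ↔ φ = kdvOp hα μ (μ⁻¹ • (φ + φ * φ)) := by
  have hrhs : ∀ x, (μ⁻¹ • (φ + φ * φ)) x = μ⁻¹ * (φ x + φ x * φ x) := fun x => rfl
  constructor
  · rintro ⟨h1, h2⟩
    obtain ⟨d1, d2, -⟩ := hasDerivAt_of_contDiff_two h1
    refine eq_kdvOp_of_hasDerivAt hα hμ d1 fun x => (d2 x).congr_deriv ?_
    rw [hrhs]
    field_simp
    linear_combination 6 * h2 x
  · intro h
    obtain ⟨h1, h2⟩ := contDiff_kdvOp hα hμ (μ⁻¹ • (φ + φ * φ))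
    rw [← h] at h1 h2
    refine ⟨h1, fun x => ?_⟩
    rw [h2, hrhs]
    field_simp
    ring

/-- With `v` the right-hand side, integration by parts for the `C²` function `v` rewrites the weak
equation as `w'' = 6μ w` in distributions for the periodic function `w = φ - v`, which forces `w =
0`. -/
theorem isKdVSolution_iff (hα : 0 < α) {μ : ℝ} (hμ : 0 < μ) (φ : HolderEven α) :
    IsKdVSolution μ φ ↔ φ = kdvOp hα μ (μ⁻¹ • (φ + φ * φ)) := by
  set g : HolderEven α := μ⁻¹ • (φ + φ * φ) with hg
  have hrhs : ∀ x, g x = μ⁻¹ * (φ x + φ x * φ x) := fun x => rfl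
  set v : HolderEven α := kdvOp hα μ g with hv
  obtain ⟨v', d1, d2⟩ := exists_hasDerivAt_kdvOp hα hμ g
  rw [← hv] at d1 d2
  have hφc := φ.continuous hα
  have hvc := v.continuous hα
  have hgc := g.continuous hα
  have hint : ∀ {f ψ : ℝ → ℝ}, Continuous f → Continuous ψ → HasCompactSupport ψ →
      Integrable fun x => f x * ψ x := fun hf hψ hs =>
    (hf.mul hψ).integrable_of_hasCompactSupport hs.mul_left
  have key : ∀ ψ : ℝ → ℝ, ContDiff ℝ ∞ ψ → HasCompactSupport ψ →
      ∫ x, (((1 - μ) * φ x + φ x ^ 2) * ψ x + 1 / 6 * φ x * iteratedDeriv 2 ψ x) =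
        1 / 6 * (∫ x, (φ x - v x) * iteratedDeriv 2 ψ x) - μ * ∫ x, (φ x - v x) * ψ x := by
    intro ψ hψ hs
    have hψ2 : ContDiff ℝ 2 ψ := by exact_mod_cast contDiff_infty.1 hψ 2
    have c2 := (hasDerivAt_of_contDiff_two hψ2).2.2
    have s2 : HasCompactSupport (iteratedDeriv 2 ψ) := by
      rw [iteratedDeriv_succ, iteratedDeriv_one]; exact hs.deriv.deriv
    have hibp := integral_mul_deriv₂ d1 d2 (by fun_prop) hψ hs
    have i1 := hint hφc c2 s2
    have i2 := hint hvc c2 s2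
    have i3 := hint hφc hψ.continuous hs
    have i4 := hint hvc hψ.continuous hs
    have i5 := hint hgc hψ.continuous hs
    have e1 : ∀ x, ((1 - μ) * φ x + φ x ^ 2) * ψ x + 1 / 6 * φ x * iteratedDeriv 2 ψ x =
        μ * (g x * ψ x) - μ * (φ x * ψ x) + 1 / 6 * (φ x * iteratedDeriv 2 ψ x) := fun x => by
      rw [hrhs]
      field_simp
      ring
    have e2 : ∀ x, 6 * μ * (v x - g x) * ψ x = 6 * μ * (v x * ψ x) - 6 * μ * (g x * ψ x) :=
      fun x => by ring
    simp only [e2] at hibp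
    rw [integral_sub (i4.const_mul _) (i5.const_mul _), integral_const_mul,
      integral_const_mul] at hibp
    have i6 : Integrable fun x => μ * (g x * ψ x) - μ * (φ x * ψ x) :=
      (i5.const_mul μ).sub (i3.const_mul μ)
    simp only [e1]
    simp only [sub_mul]
    rw [integral_add i6 (i1.const_mul _),
      integral_sub (i5.const_mul μ) (i3.const_mul μ), integral_sub i1 i2, integral_sub i3 i4,
      integral_const_mul, integral_const_mul, integral_const_mul, hibp]
    ring
  constructor
  · intro h
    refine HolderEven.ext fun x => sub_eq_zero.1 ?_
    refine eq_zero_of_periodic_of_distributional (w := fun x => φ x - v x) Real.two_pi_pos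
      (Real.sqrt_pos.2 (by positivity : 0 < 6 * μ)).ne' (hφc.sub hvc)
      (fun x => by simp only [φ.periodic x, v.periodic x]) (fun ψ hψ hs => ?_) x
    have h1 := key ψ hψ hs
    rw [h ψ hψ hs] at h1
    rw [Real.sq_sqrt (by positivity)]
    linarith
  · intro h ψ hψ hs
    rw [key ψ hψ hs]
    simp only [← h, sub_self, zero_mul, integral_zero, mul_zero]

theorem isFormulation_kdv (hα : 0 < α) {S : ℝ → (ℝ → ℝ) → Prop}
    (hS : ∀ (φ : HolderEven α) (μ : ℝ), 0 < μ →
      (S μ φ ↔ φ = kdvOp hα μ (μ⁻¹ • (φ + φ * φ)))) :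
    IsFormulation S (kdvOp hα) (fun p => -(kdvOp hα p.2 (p.1 * p.1))) := by
  have hN : ∀ μ, HasFDerivAt (fun φ : HolderEven α => -(kdvOp hα μ (φ * φ)))
      (0 : HolderEven α →L[ℝ] HolderEven α) 0 := fun μ => by
    have h := (kdvOp hα μ).hasFDerivAt.comp (0 : HolderEven α)
      (HolderEven.hasFDerivAt_neg_mul_self (α := α))
    rw [ContinuousLinearMap.comp_zero] at h
    refine h.congr_of_eventuallyEq (Eventually.of_forall fun φ => ?_)
    exact (map_neg (kdvOp hα μ) (φ * φ)).symm
  refine ⟨fun μ hμ => isCompactOperator_of_mem_closure (kdvOp_mem_closure hα hμ),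
    analyticOnNhd_opF (analyticOnNhd_kdvOp hα) fun p hp => ?_,
    fun φ μ hμ => (hS φ μ hμ).trans (opF_kdv_eq_zero_iff hα hμ φ).symm,
    fun μ _ => hN μ, fun μ hμ => exists_fredholm_hasFDerivAt hμ (kdvOp_mem_closure hα hμ) (hN μ)⟩
  have h1 : AnalyticAt ℝ (fun q : HolderEven α × ℝ => kdvOp hα q.2) p :=
    (analyticOnNhd_kdvOp hα p.2 hp).comp analyticAt_snd
  have h2 : AnalyticAt ℝ (fun q : HolderEven α × ℝ => q.1 * q.1) p :=
    (HolderEven.analyticOnNhd_mul_self Set.univ p.1 trivial).comp analyticAt_fst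
  exact (((ContinuousLinearMap.id ℝ (HolderEven α →L[ℝ] HolderEven α)).analyticAt_bilinear
    (kdvOp hα p.2, p.1 * p.1)).comp₂ h1 h2).neg

end KdV

end Whitham

theorem theorem3p1 (α : ℝ≥0) (hα : 1 / 2 < α) (hα' : α < 1) :
    -- the Whitham equation: `L` and `N` do not depend on `μ`
    ((∃ K : ℝ → ℝ, Whitham.IsWhithamKernel K) ∧
      ∀ K : ℝ → ℝ, Whitham.IsWhithamKernel K →
        ∃ L : Whitham.HolderEven α →L[ℝ] Whitham.HolderEven α,
          (∀ (f : Whitham.HolderEven α) (x : ℝ), L f x = (K ⋆ f) x) ∧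
          Whitham.IsFormulation (Whitham.IsWhithamSolution K) (fun _ => L)
            (fun p => -(p.1 * p.1))) ∧
    -- the KdV equation
    (∃ L : ℝ → Whitham.HolderEven α →L[ℝ] Whitham.HolderEven α,
      (∀ μ : ℝ, 0 < μ → ∀ f : Whitham.HolderEven α,
        (∀ x : ℝ, L μ f x = (Whitham.resolventKernel (1 / √(6 * μ)) ⋆ f) x) ∧
        ContDiff ℝ 2 (L μ f) ∧
        ∀ x : ℝ, L μ f x - 1 / (6 * μ) * iteratedDeriv 2 (L μ f) x = f x) ∧
      Whitham.IsFormulation Whitham.IsKdVSolution L (fun p => -(L p.2 (p.1 * p.1))) ∧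
      Whitham.IsFormulation Whitham.IsClassicalKdVSolution L
        (fun p => -(L p.2 (p.1 * p.1)))) := by
  have h0 : 0 < α := lt_trans (by norm_num) hα
  refine ⟨⟨Whitham.exists_isWhithamKernel, fun K hK =>
    ⟨Whitham.HolderEven.evenConv h0 K hK.1, fun f x =>
      (Whitham.HolderEven.convolution_eq_evenConv h0 hK.1 f x
        (hK.integral_sub_eq_integral_add h0 f x)).symm, hK.isFormulation h0⟩⟩,
    Whitham.kdvOp h0, fun μ hμ f => ?_,
    Whitham.isFormulation_kdv h0 fun φ μ hμ => Whitham.isKdVSolution_iff h0 hμ φ,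
    Whitham.isFormulation_kdv h0 fun φ μ hμ => Whitham.isClassicalKdVSolution_iff h0 hμ φ⟩
  obtain ⟨h1, h2⟩ := Whitham.contDiff_kdvOp h0 hμ f
  refine ⟨Whitham.kdvOp_apply h0 hμ f, h1, fun x => ?_⟩
  rw [h2]
  field_simp
  ring
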